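/- Let $F$ be a finite bipartite graph with vertex bipartition $V(F)=U\cup V$, let $G$ be a finite abelian group, and let $A\subseteq G$. A map $\phi\colon V(F)\to G$ \emph{bi-induces} $F$ in $A$ if for every $(u,v)\in U\times V$, $uv$ is an edge of $F$ if and only if $\phi(u)+\phi(v)\in A$. The set $A$ \emph{has a bi-induced copy of $F$} if some such $\phi$ is injective on $U$ and injective on $V$; otherwise $A$ is \emph{bi-induced-$F$-free}. The set $A$ is \emph{$\epsilon$-far from bi-induced-$F$-free} if every $A'\subseteq G$ with $|A\mathbin{\Delta}A'|\le\epsilon|G|$ has a bi-induced copy of $F$. \textbf{Theorem 2 (Removal lemma).} For every positive integer $r$ there is a constant $C=C(r)$ such that for every finite bipartite graph $F$ as above, every finite abelian group $G$ of exponent at most $r$, every $0<\epsilon<1/2$, and every $A\subseteq G$ that is $\epsilon$-far from bi-induced-$F$-free, a uniformly random map $\phi\colon V(F)\to G$ bi-induces $F$ in $A$ with probability at least $\epsilon^{C|V(F)|^3}$. Consequently, bi-induced-$F$-freeness can be tested with polynomially many queries: for every $r$ and $F$ there is a constant $D=D(r,F)$ such that for every $0<\epsilon<1/2$ there is an integer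 $t\le\epsilon^{-D}$ with the following property for all finite abelian groups $G$ of exponent at most $r$ and all $A\subseteq G$. Sample $t$ independent uniformly random maps $\phi_1,\dots,\phi_t\colon V(F)\to G$, query membership in $A$ of $\phi_i(u)+\phi_i(v)$ for all $i$ and all $(u,v)\in U\times V$, and output YES if some $\phi_i$ bi-induces $F$ in $A$ and is injective on each of $U$ and $V$, and NO otherwise. If $A$ is bi-induced-$F$-free, the output is always NO; if $A$ is $\epsilon$-far from bi-induced-$F$-free, the output is YES with probability at least $2/3$. -/

import Mathlib

open scoped symmDiff

universe u v

namespace BiInduced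

/-- The probability that a uniformly random element of the (finite, nonempty) type `α`
satisfies `p`. -/
noncomputable def uniformProb (α : Type*) (p : α → Prop) : ℝ :=
  (Nat.card {x : α // p x} : ℝ) / (Nat.card α : ℝ)

section Patterns

variable {W : Type*} {G : Type*} [AddCommGroup G]

/-- `F` is a bipartite graph with vertex bipartition `W = U ∪ V` (either part may be empty). -/
def HasBipartition (F : SimpleGraph W) (U V : Set W) : Prop :=
  F.IsBipartiteWith U V ∧ U ∪ V = Set.univ

/-- The map `φ` bi-induces `F`, with vertex parts `U` and `V`, in `A`. -/
def BiInduces (F : SimpleGraph W) (U V : Set W) (A : Set G) (φ : W → G) : Prop :=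
  ∀ u ∈ U, ∀ v ∈ V, (F.Adj u v ↔ φ u + φ v ∈ A)

/-- `φ` bi-induces `F` in `A` and is injective on each of the two vertex parts. -/
def IsBiInducedCopy (F : SimpleGraph W) (U V : Set W) (A : Set G) (φ : W → G) : Prop :=
  BiInduces F U V A φ ∧ Set.InjOn φ U ∧ Set.InjOn φ V

/-- `A` has a bi-induced copy of `F`. -/
def HasBiInducedCopy (F : SimpleGraph W) (U V : Set W) (A : Set G) : Prop :=
  ∃ φ : W → G, IsBiInducedCopy F U V A φ

/-- `A` is `ε`-far from bi-induced-`F`-free: every `A'` that differs from `A` in at most `ε |G|`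
elements has a bi-induced copy of `F`. -/
def IsFarFromFree (F : SimpleGraph W) (U V : Set W) (ε : ℝ) (A : Set G) : Prop :=
  ∀ A' : Set G, ((A ∆ A').ncard : ℝ) ≤ ε * (Nat.card G : ℝ) → HasBiInducedCopy F U V A'

/-- The outcome YES of the sampling algorithm with `t` rounds on the samples `Φ`: in round `i` it
queries membership in `A` of the `|U| |V|` elements `Φ i u + Φ i v`, and it answers YES when the
sampled map of some round bi-induces `F` in `A` and is injective on each vertex part. -/
def TesterSaysYes (F : SimpleGraph W) (U V : Set W) (A : Set G) {t : ℕ}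
    (Φ : Fin t → W → G) : Prop :=
  ∃ i : Fin t, IsBiInducedCopy F U V A (Φ i)

end Patterns

end BiInduced

/-! Suppose that `A` is `ε`-far but random maps rarely bi-induce `F`; write `n` for the number of
vertices. Rarity forces many almost periods, elements `x` with `A` and `A - x` nearly equal.
Otherwise many random translates of `A` would have distinct traces on a few random points. By
Sauer–Shelah these traces would shatter `n` points and so exhibit `F`, although a union bound shows
that such a sample usually contains no pattern (`card_almostPeriods_ge`).

Next, a subgroup `H` of index polynomial in `1/ε` is found on which the almost periods do not
concentrate in any proper subgroup. By Fourier analysis and bounded exponent, `A` is then nearly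
invariant under an average translation by `H` (`sum_shiftDist_le`). The identity of `G` agrees
modulo `H` with an endomorphism `σ` of small range `Q` (`exists_hom_small_range`). Hence for a
typical `t ∈ H` the set `{g | σ g + t ∈ A}` is close to `A`, and farness gives it a copy `φ₀` of
`F`.

All sums of `σ ∘ φ₀` lie in the small group `Q`. For typical `t`, most perturbations of the vertices
by much finer almost periods therefore preserve every adjacency (`card_almostPeriods_pow_le`). The
number of bi-inducing maps is then at least half the `n`-th power of the number of fine almost
periods. The fine scale is a power of `ε` linear in `n`, their density is that scale to the power
`24 n`, and there are `n` vertices, whence the cubic exponent.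

For testing, non-injective maps are negligible in a large group, while in a small group a single
copy already has enough probability. -/

namespace BiInduced

open Finset

/-! ### Uniform probability on finite types. -/

section UniformProb

theorem uniformProb_eq_card_filter {α : Type*} [Fintype α] (p : α → Prop) [DecidablePred p] :
    uniformProb α p = (#{x : α | p x} : ℝ) / Fintype.card α := by
  rw [uniformProb, Nat.card_eq_fintype_card, Nat.card_eq_fintype_card, Fintype.card_subtype]

theorem uniformProb_nonneg {α : Type*} (p : α → Prop) : 0 ≤ uniformProb α p := by
  unfold uniformProb; positivity

theorem uniformProb_mono {α : Type*} [Finite α] {p q : α → Prop} (h : ∀ x, p x → q x) :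
    uniformProb α p ≤ uniformProb α q := by
  classical
  have := Fintype.ofFinite α
  rw [uniformProb_eq_card_filter, uniformProb_eq_card_filter]
  gcongr with x
  exact h x

theorem uniformProb_or_le {α : Type*} [Finite α] (p q : α → Prop) :
    uniformProb α (fun x => p x ∨ q x) ≤ uniformProb α p + uniformProb α q := by
  classical
  have := Fintype.ofFinite α
  rw [uniformProb_eq_card_filter, uniformProb_eq_card_filter, uniformProb_eq_card_filter,
    ← add_div, filter_or]
  gcongr
  exact_mod_cast card_union_le _ _

theorem uniformProb_exists_le {α ι : Type*} [Finite α] [Fintype ι] (p : ι → α → Prop) :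
    uniformProb α (fun x => ∃ i, p i x) ≤ ∑ i, uniformProb α (p i) := by
  classical
  have := Fintype.ofFinite α
  simp only [uniformProb_eq_card_filter]
  rw [← Finset.sum_div]
  gcongr
  have : ({x | ∃ i, p i x} : Finset α) = univ.biUnion fun i => ({x | p i x} : Finset α) := by
    ext; simp
  rw [this]
  exact_mod_cast card_biUnion_le

theorem exists_not_of_uniformProb_lt_one {α : Type*} [Finite α] [Nonempty α] {p : α → Prop}
    (h : uniformProb α p < 1) : ∃ x, ¬ p x := by
  by_contra! hp
  have hc : Nat.card {x // p x} = Nat.card α := Nat.card_congr (Equiv.subtypeUnivEquiv hp)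
  rw [uniformProb, hc, div_self (by exact_mod_cast Nat.card_pos.ne')] at h
  exact lt_irrefl _ h

theorem uniformProb_congr_equiv {α β : Type*} (e : α ≃ β) (p : β → Prop) :
    uniformProb α (fun x => p (e x)) = uniformProb β p := by
  rw [uniformProb, uniformProb, Nat.card_congr e,
    Nat.card_congr (e.subtypeEquiv (q := p) fun _ => Iff.rfl)]

theorem uniformProb_prod_fst {α β : Type*} [Finite β] [Nonempty β] (p : α → Prop) :
    uniformProb (α × β) (fun x => p x.1) = uniformProb α p := by
  have e : {x : α × β // p x.1} ≃ {x : α // p x} × β :=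
    { toFun := fun x => (⟨x.1.1, x.2⟩, x.1.2)
      invFun := fun x => ⟨(x.1.1, x.2), x.1.2⟩
      left_inv := fun _ => rfl
      right_inv := fun _ => rfl }
  have hβ : (Nat.card β : ℝ) ≠ 0 := by exact_mod_cast Nat.card_pos.ne'
  rw [uniformProb, uniformProb, Nat.card_congr e, Nat.card_prod, Nat.card_prod]
  push_cast
  rw [mul_div_mul_right _ _ hβ]

/-- Restricting a uniformly random function along an injection gives a uniformly random function. -/
theorem uniformProb_comp_injective {ι α G : Type*} [Finite ι] [Finite G] [Nonempty G]
    {κ : α → ι} (hκ : Function.Injective κ) (p : (α → G) → Prop) :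
    uniformProb (ι → G) (fun z => p (z ∘ κ)) = uniformProb (α → G) p := by
  classical
  let e₁ := Equiv.piEquivPiSubtypeProd (fun i : ι => i ∈ Set.range κ) (fun _ => G)
  let e₂ : ({i // i ∈ Set.range κ} → G) ≃ (α → G) := (Equiv.ofInjective κ hκ).symm.arrowCongr
    (Equiv.refl G)
  rw [← uniformProb_congr_equiv e₂ p]
  exact (uniformProb_congr_equiv e₁ (fun x => p (e₂ x.1))).trans
    (uniformProb_prod_fst (fun x => p (e₂ x)))

theorem uniformProb_not {α : Type*} [Finite α] [Nonempty α] (p : α → Prop) :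
    uniformProb α (fun x => ¬ p x) = 1 - uniformProb α p := by
  classical
  have := Fintype.ofFinite α
  have h0 : (Fintype.card α : ℝ) ≠ 0 := by exact_mod_cast Fintype.card_ne_zero
  rw [uniformProb_eq_card_filter, uniformProb_eq_card_filter, eq_sub_iff_add_eq, ← add_div,
    div_eq_one_iff_eq h0, add_comm]
  exact_mod_cast Finset.card_filter_add_card_filter_not (s := univ) p

end UniformProb

/-! ### Almost periods and agreement of random translates. -/

section AlmostPeriods

variable {G : Type*} [AddCommGroup G] [Fintype G]

open scoped Classical in
/-- The number of elements on which the indicator functions of `A` and of its translate by `-x`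
differ. -/
noncomputable def shiftDist (A : Set G) (x : G) : ℕ := #{g : G | ¬ (g ∈ A ↔ x + g ∈ A)}

open scoped Classical in
/-- The elements whose translation changes `A` on at most a `δ` fraction of the group. -/
noncomputable def almostPeriods (A : Set G) (δ : ℝ) : Finset G :=
  {x : G | (shiftDist A x : ℝ) ≤ δ * Fintype.card G}

theorem mem_almostPeriods {A : Set G} {δ : ℝ} {x : G} :
    x ∈ almostPeriods A δ ↔ (shiftDist A x : ℝ) ≤ δ * Fintype.card G := by
  simp [almostPeriods]

theorem shiftDist_le_card (A : Set G) (x : G) : shiftDist A x ≤ Fintype.card G :=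
  card_le_univ _

open scoped Classical in
theorem card_filter_shift_ne (A : Set G) (a b : G) :
    #{g : G | ¬ (a + g ∈ A ↔ b + g ∈ A)} = shiftDist A (b - a) := by
  refine card_bij (fun g _ => a + g) ?_ (fun _ _ _ _ h => add_left_cancel h) ?_
  · intro g hg
    have : b - a + (a + g) = b + g := by abel
    simpa [this] using hg
  · intro g hg
    refine ⟨g - a, ?_, by abel⟩
    have h1 : b + (g - a) = b - a + g := by abel
    have h2 : a + (g - a) = g := by abel
    simpa [h1, h2] using hg

open scoped Classical in
theorem card_filter_shift_eq (A : Set G) (a b : G) :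
    #{g : G | (a + g ∈ A ↔ b + g ∈ A)} = Fintype.card G - shiftDist A (b - a) := by
  rw [← card_filter_shift_ne, ← card_compl]
  congr 1
  ext g
  simp

theorem shiftDist_zero (A : Set G) : shiftDist A 0 = 0 := by
  simp [shiftDist]

theorem zero_mem_almostPeriods (A : Set G) {δ : ℝ} (hδ : 0 ≤ δ) : (0 : G) ∈ almostPeriods A δ := by
  rw [mem_almostPeriods, shiftDist_zero]
  push_cast
  positivity

theorem shiftDist_add_le (A : Set G) (x y : G) :
    shiftDist A (x + y) ≤ shiftDist A x + shiftDist A y := by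
  classical
  have h : shiftDist A x = #{g : G | ¬ (y + g ∈ A ↔ x + y + g ∈ A)} := by
    rw [card_filter_shift_ne]; congr 1; abel
  rw [h, shiftDist, shiftDist, add_comm]
  refine (card_le_card ?_).trans (card_union_le _ _)
  intro g
  simp only [mem_union, mem_filter, mem_univ, true_and]
  tauto

/-- The probability that two random translates of `A` agree on `s` random points. -/
theorem uniformProb_agree_le (A : Set G) {δ : ℝ} (hδ : δ ≤ 1) (s : ℕ) :
    uniformProb (Fin 2 ⊕ Fin s → G) (fun w => ∀ k : Fin s,
      (w (.inl 0) + w (.inr k) ∈ A ↔ w (.inl 1) + w (.inr k) ∈ A)) ≤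
      (#(almostPeriods A δ) : ℝ) / Fintype.card G + (1 - δ) ^ s := by
  classical
  let e : (Fin 2 ⊕ Fin s → G) ≃ (G × G) × (Fin s → G) :=
    (Equiv.sumArrowEquivProdArrow _ _ _).trans
      ((finTwoArrowEquiv G).prodCongr (Equiv.refl _))
  have key := uniformProb_congr_equiv e (fun z : (G × G) × (Fin s → G) =>
    ∀ k, (z.1.1 + z.2 k ∈ A ↔ z.1.2 + z.2 k ∈ A))
  refine (le_of_eq key).trans ?_
  rw [uniformProb_eq_card_filter]
  have hG : (0 : ℝ) < Fintype.card G := by exact_mod_cast Fintype.card_pos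
  set c : ℝ := (Fintype.card G : ℝ) with hc
  have hcount : (#{z : (G × G) × (Fin s → G) |
      ∀ k, (z.1.1 + z.2 k ∈ A ↔ z.1.2 + z.2 k ∈ A)} : ℝ)
      = ∑ a : G, ∑ b : G, ((Fintype.card G - shiftDist A b : ℕ) : ℝ) ^ s := by
    rw [card_filter, Fintype.sum_prod_type, Fintype.sum_prod_type]
    push_cast
    refine Finset.sum_congr rfl fun a _ => ?_
    -- Replacing `b` by `b + a` makes the agreement count depend on the difference of the two
    -- translates only.
    rw [← Equiv.sum_comp (Equiv.addRight a)]
    refine Finset.sum_congr rfl fun b _ => ?_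
    have : ({y : Fin s → G | ∀ k, (a + y k ∈ A ↔ b + a + y k ∈ A)} : Finset _)
        = Fintype.piFinset fun _ : Fin s => ({g : G | (a + g ∈ A ↔ b + a + g ∈ A)} : Finset G) := by
      ext; simp [Fintype.mem_piFinset]
    have h2 := congrArg Finset.card this
    rw [Fintype.card_piFinset, Finset.prod_const, card_univ, Fintype.card_fin,
      card_filter_shift_eq, add_sub_cancel_right, card_filter] at h2
    exact_mod_cast h2
  rw [hcount]
  have hterm : ∀ b : G, ((Fintype.card G - shiftDist A b : ℕ) : ℝ) ^ s ≤
      (if b ∈ almostPeriods A δ then c ^ s else 0) + (1 - δ) ^ s * c ^ s := by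
    intro b
    have h0 : ((Fintype.card G - shiftDist A b : ℕ) : ℝ) = c - shiftDist A b := by
      rw [Nat.cast_sub (shiftDist_le_card A b)]
    have hδ' : (0 : ℝ) ≤ 1 - δ := by linarith
    -- An almost period gets the trivial bound; any other difference makes each point agree with
    -- probability below `1 - δ`.
    by_cases hb : b ∈ almostPeriods A δ
    · rw [if_pos hb]
      have : ((Fintype.card G - shiftDist A b : ℕ) : ℝ) ^ s ≤ c ^ s := by
        refine pow_le_pow_left₀ (by positivity) ?_ s
        rw [hc]
        exact_mod_cast Nat.sub_le _ _
      have : 0 ≤ (1 - δ) ^ s * c ^ s := by positivity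
      linarith
    · rw [if_neg hb, zero_add, ← mul_pow]
      refine pow_le_pow_left₀ (by positivity) ?_ s
      rw [mem_almostPeriods, not_le] at hb
      rw [h0]
      linarith
  have hcard : (Fintype.card ((G × G) × (Fin s → G)) : ℝ) = c * (c * c ^ s) := by
    simp [c, mul_assoc]
  rw [hcard, div_le_iff₀ (by positivity)]
  calc ∑ a : G, ∑ b : G, ((Fintype.card G - shiftDist A b : ℕ) : ℝ) ^ s
      ≤ ∑ a : G, ∑ b : G, ((if b ∈ almostPeriods A δ then c ^ s else 0) + (1 - δ) ^ s * c ^ s) := by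
        gcongr with a _ b _
        exact hterm b
    _ = _ := by
        simp only [sum_add_distrib, sum_const, card_univ, nsmul_eq_mul, Finset.sum_ite_mem,
          univ_inter]
        field_simp
        ring

end AlmostPeriods

/-! ### Distinct traces, shattering and patterns. -/

section Packing

variable {W : Type*} [Finite W] {F : SimpleGraph W} {U V : Set W}

/-- A set system with a shattered set of size `|W|` contains the pattern `F`, with distinct sets for
distinct vertices of `U`. -/
theorem exists_pattern_of_shatters (hF : HasBipartition F U V) {ι κ : Type*} [Fintype ι]
    [DecidableEq κ] (S : ι → Finset κ) {T : Finset κ}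
    (hT : (univ.image S).Shatters T) (hcard : Nat.card W ≤ #T) :
    ∃ (i : W → ι) (j : W → κ), Set.InjOn i U ∧ Function.Injective j ∧
      ∀ u ∈ U, ∀ v ∈ V, (F.Adj u v ↔ j v ∈ S (i u)) := by
  classical
  have := Fintype.ofFinite W
  obtain ⟨e⟩ : Nonempty (W ↪ T) := Function.Embedding.nonempty_of_card_le (by
    rwa [Fintype.card_coe, ← Nat.card_eq_fintype_card])
  let j : W → κ := fun w => e w
  have hj : Function.Injective j := Subtype.val_injective.comp e.injective
  have hjT : ∀ w, j w ∈ T := fun w => (e w).2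
  -- The extra point `j u` makes the chosen sets distinct for distinct `u ∈ U`. It does not disturb
  -- the pattern, since `u ∉ V`.
  let t : W → Finset κ := fun u => ({w | (w ∈ V ∧ F.Adj u w) ∨ w = u} : Finset W).image j
  have hmem : ∀ u w, j w ∈ t u ↔ (w ∈ V ∧ F.Adj u w) ∨ w = u := by
    intro u w
    simp only [t, mem_image, mem_filter, mem_univ, true_and]
    exact ⟨fun ⟨a, ha, hw⟩ => hj hw ▸ ha, fun h => ⟨w, h, rfl⟩⟩
  have hex : ∀ u, ∃ i, T ∩ S i = t u := by
    intro u
    have ht : t u ⊆ T := by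
      intro x hx
      obtain ⟨w, -, rfl⟩ := mem_image.1 hx
      exact hjT w
    obtain ⟨s, hs, hst⟩ := hT ht
    obtain ⟨i, -, rfl⟩ := mem_image.1 hs
    exact ⟨i, hst⟩
  choose i hi using hex
  have hUV : ∀ w, w ∈ U → w ∉ V := fun w hu hv => Set.disjoint_left.1 hF.1.disjoint hu hv
  refine ⟨i, j, ?_, hj, ?_⟩
  · intro u hu u' _ huu
    have h : j u ∈ t u' := by
      rw [← hi u', ← huu, hi u, hmem]
      exact Or.inr rfl
    rcases (hmem _ _).1 h with h | h
    · exact absurd h.1 (hUV u hu)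
    · exact h
  · intro u hu v hv
    have h : j v ∈ t u ↔ j v ∈ S (i u) := by
      rw [← hi u, mem_inter]
      exact and_iff_right (hjT v)
    rw [← h, hmem]
    have : v ≠ u := fun h => hUV u hu (h ▸ hv)
    tauto

theorem card_le_sum_choose_of_not_shatters {κ : Type*} [Fintype κ] [DecidableEq κ]
    (𝒜 : Finset (Finset κ)) {n : ℕ} (h : ∀ T, 𝒜.Shatters T → #T < n) :
    #𝒜 ≤ ∑ k ∈ range n, (Fintype.card κ).choose k := by
  refine 𝒜.card_le_card_shatterer.trans ?_
  have hsub : 𝒜.shatterer ⊆ (range n).biUnion fun k => powersetCard k univ := by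
    intro T hT
    simp only [mem_biUnion, mem_range, mem_powersetCard, subset_univ, true_and]
    exact ⟨#T, h T (mem_shatterer.1 hT), rfl⟩
  refine (card_le_card hsub).trans (card_biUnion_le.trans ?_)
  simp

variable {G : Type*} [AddCommGroup G] [Fintype G]

/-- The hypothesis is a union bound over pairs of translates with equal traces and over placements
of `W` among the samples. Some sample of `N` translates and `s` points avoids both events, so its
`N` traces are distinct and shatter no set of size `Nat.card W`; Sauer–Shelah bounds their number.
-/
theorem le_sum_choose_of_few_patterns (hF : HasBipartition F U V) (A : Set G) {δ : ℝ} (hδ : δ ≤ 1)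
    (N s : ℕ)
    (h : (N : ℝ) ^ 2 * ((#(almostPeriods A δ) : ℝ) / Fintype.card G + (1 - δ) ^ s) +
      ((N + s : ℕ) : ℝ) ^ Nat.card W * uniformProb (W → G) (BiInduces F U V A) < 1) :
    N ≤ ∑ k ∈ range (Nat.card W), s.choose k := by
  classical
  have := Fintype.ofFinite W
  set β : ℝ := (#(almostPeriods A δ) : ℝ) / Fintype.card G + (1 - δ) ^ s with hβ
  have hβ0 : 0 ≤ β := by
    have : (0 : ℝ) ≤ 1 - δ := by linarith
    positivity
  let agree : {x : Fin N × Fin N // x.1 ≠ x.2} → (Fin N ⊕ Fin s → G) → Prop := fun x z =>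
    ∀ k : Fin s, (z (.inl x.1.1) + z (.inr k) ∈ A ↔ z (.inl x.1.2) + z (.inr k) ∈ A)
  let pattern : (W ↪ Fin N ⊕ Fin s) → (Fin N ⊕ Fin s → G) → Prop := fun κ z =>
    BiInduces F U V A (z ∘ κ)
  have hagree : ∀ x, uniformProb _ (agree x) ≤ β := by
    intro x
    let κ : Fin 2 ⊕ Fin s → Fin N ⊕ Fin s := Sum.map ![x.1.1, x.1.2] id
    have hκ : Function.Injective κ := by
      refine Function.Injective.sumMap ?_ Function.injective_id
      intro a b hab
      have := x.2
      fin_cases a <;> fin_cases b <;> simp_all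
    have h1 := uniformProb_comp_injective (G := G) hκ (fun w => ∀ k : Fin s,
      (w (.inl 0) + w (.inr k) ∈ A ↔ w (.inl 1) + w (.inr k) ∈ A))
    have h2 := uniformProb_agree_le A hδ s
    rw [← h1] at h2
    exact h2
  have hpattern : ∀ κ, uniformProb _ (pattern κ) ≤ uniformProb (W → G) (BiInduces F U V A) :=
    fun κ => (uniformProb_comp_injective κ.injective (BiInduces F U V A)).le
  have hprob : uniformProb (Fin N ⊕ Fin s → G)
      (fun z => (∃ x, agree x z) ∨ ∃ κ, pattern κ z) < 1 := by
    refine lt_of_le_of_lt ?_ h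
    refine (uniformProb_or_le _ _).trans (add_le_add ?_ ?_)
    · refine (uniformProb_exists_le _).trans ((sum_le_card_nsmul _ _ _ fun x _ => hagree x).trans ?_)
      rw [nsmul_eq_mul]
      refine mul_le_mul_of_nonneg_right ?_ hβ0
      have : Fintype.card {x : Fin N × Fin N // x.1 ≠ x.2} ≤ N ^ 2 :=
        (Fintype.card_subtype_le _).trans (by simp [sq])
      rw [card_univ]
      exact_mod_cast this
    · refine (uniformProb_exists_le _).trans
        ((sum_le_card_nsmul _ _ _ fun x _ => hpattern x).trans ?_)
      rw [nsmul_eq_mul]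
      refine mul_le_mul_of_nonneg_right ?_ (uniformProb_nonneg _)
      have : Fintype.card (W ↪ Fin N ⊕ Fin s) ≤ (N + s) ^ Nat.card W :=
        (Fintype.card_le_of_injective (fun κ : W ↪ Fin N ⊕ Fin s => (κ : W → _))
          DFunLike.coe_injective).trans (by simp [Nat.card_eq_fintype_card])
      rw [card_univ]
      exact_mod_cast this
  obtain ⟨z, hz⟩ := exists_not_of_uniformProb_lt_one hprob
  push Not at hz
  obtain ⟨hz1, hz2⟩ := hz
  let S : Fin N → Finset (Fin s) := fun i => {k | z (.inl i) + z (.inr k) ∈ A}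
  have hS : Function.Injective S := by
    intro i j hij
    by_contra hne
    refine hz1 ⟨(i, j), hne⟩ fun k => ?_
    have := Finset.ext_iff.1 hij k
    simpa [S] using this
  have hfam : #(univ.image S) = N := by
    rw [card_image_of_injective _ hS, card_univ, Fintype.card_fin]
  rw [← hfam]
  refine (card_le_sum_choose_of_not_shatters _ (n := Nat.card W) ?_).trans (by simp)
  intro T hT
  by_contra! hcard
  obtain ⟨i, j, hi, hj, hij⟩ := exists_pattern_of_shatters hF S hT hcard
  have hUV : ∀ w, w ∈ V → w ∉ U := fun w hv hu => Set.disjoint_left.1 hF.1.disjoint hu hv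
  -- Vertices of `U` become translates and all others become points, so a shattered set yields one
  -- of the forbidden placements.
  let κ : W → Fin N ⊕ Fin s := fun w => if w ∈ U then .inl (i w) else .inr (j w)
  have hκ : Function.Injective κ := by
    intro a b hab
    by_cases ha : a ∈ U <;> by_cases hb : b ∈ U <;> simp only [κ, ha, hb, if_true, if_false] at hab
    · exact hi ha hb (Sum.inl_injective hab)
    · cases hab
    · cases hab
    · exact hj (Sum.inr_injective hab)
  refine hz2 ⟨κ, hκ⟩ fun u hu v hv => ?_
  rw [hij u hu v hv]
  simp [κ, S, hu, hUV v hv]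

end Packing

/-! ### A bound for partial sums of binomial coefficients. -/

section Choose

/-- The standard bound for a sum of binomial coefficients. -/
theorem sum_choose_le (M n : ℕ) (hM : 0 < M) :
    ((∑ k ∈ range n, (M * n).choose k : ℕ) : ℝ) ≤ (3 * M : ℝ) ^ n := by
  have hM' : (1 : ℝ) ≤ M := by exact_mod_cast hM
  have hinv : (M : ℝ)⁻¹ ≤ 1 := inv_le_one_of_one_le₀ hM'
  -- Since `M⁻¹ ≤ 1` and `k < n`, the factor `M⁻¹ ^ n` is at most `M⁻¹ ^ k`; the sum becomes part of
  -- a binomial expansion.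
  have h1 : ((∑ k ∈ range n, (M * n).choose k : ℕ) : ℝ) * ((M : ℝ)⁻¹) ^ n ≤
      (1 + (M : ℝ)⁻¹) ^ (M * n) := by
    rw [add_comm, add_pow]
    push_cast
    rw [Finset.sum_mul]
    calc ∑ k ∈ range n, ((M * n).choose k : ℝ) * ((M : ℝ)⁻¹) ^ n
        ≤ ∑ k ∈ range n, ((M : ℝ)⁻¹) ^ k * 1 ^ (M * n - k) * ((M * n).choose k : ℝ) := by
          refine Finset.sum_le_sum fun k hk => ?_
          rw [one_pow, mul_one, mul_comm]
          refine mul_le_mul_of_nonneg_right ?_ (by positivity)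
          exact pow_le_pow_of_le_one (by positivity) hinv (mem_range.1 hk).le
      _ ≤ _ := by
          refine Finset.sum_le_sum_of_subset_of_nonneg ?_ fun _ _ _ => by positivity
          refine range_subset_range.2 ?_
          nlinarith
  have h2 : (1 + (M : ℝ)⁻¹) ^ (M * n) ≤ 3 ^ n := by
    rw [pow_mul]
    refine pow_le_pow_left₀ (by positivity) ?_ n
    have h3 : (1 + (M : ℝ)⁻¹) ≤ Real.exp ((M : ℝ)⁻¹) := by
      rw [add_comm]; exact Real.add_one_le_exp _
    calc (1 + (M : ℝ)⁻¹) ^ M ≤ Real.exp ((M : ℝ)⁻¹) ^ M := pow_le_pow_left₀ (by positivity) h3 M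
      _ = Real.exp 1 := by
          rw [← Real.exp_nat_mul, mul_inv_cancel₀ (by positivity)]
      _ ≤ 3 := Real.exp_one_lt_three.le
  have h4 := h1.trans h2
  rw [inv_pow, ← div_eq_mul_inv, div_le_iff₀ (by positivity)] at h4
  rw [mul_pow]
  exact h4

end Choose

/-! ### Few copies of the pattern force many almost periods. -/

section AlmostPeriodsBound

variable {W : Type*} [Finite W] {F : SimpleGraph W} {U V : Set W}
variable {G : Type*} [AddCommGroup G] [Fintype G]

/-- The quartic term of the exponential suffices: `(δ * M) ^ 4 = (δ ^ 2 * M) ^ 2 * M ^ 2`, and `δ ^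
2 * M ≥ 100`. Taking `M` of order `δ ^ (-2)` avoids logarithms. -/
theorem sq_mul_exp_neg_mul_le {δ : ℝ} (hδ0 : 0 < δ) {M : ℝ}
    (hM : 100 / δ ^ 2 ≤ M) : 16 * M ^ 2 * Real.exp (-(δ * M)) ≤ 1 / 4 := by
  have hM0 : 0 < M := lt_of_lt_of_le (by positivity) hM
  have h1 : (δ * M) ^ 4 / 24 ≤ Real.exp (δ * M) := by
    have := Real.pow_div_factorial_le_exp (δ * M) (by positivity) 4
    simpa [Nat.factorial] using this
  have h2 : 100 ≤ δ ^ 2 * M := by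
    rw [div_le_iff₀ (by positivity)] at hM
    linarith
  have h3 : (100 : ℝ) ^ 2 ≤ (δ ^ 2 * M) ^ 2 := pow_le_pow_left₀ (by norm_num) h2 2
  rw [Real.exp_neg, ← div_eq_mul_inv, div_le_iff₀ (Real.exp_pos _)]
  have h4 : (δ * M) ^ 4 = (δ ^ 2 * M) ^ 2 * M ^ 2 := by ring
  rw [h4] at h1
  have h5 : (100 : ℝ) ^ 2 * M ^ 2 ≤ (δ ^ 2 * M) ^ 2 * M ^ 2 := by gcongr
  nlinarith [sq_nonneg M]

/-- If `A` contains few copies of `F` then it has many almost periods. -/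
theorem card_almostPeriods_ge (hF : HasBipartition F U V) (hW : 0 < Nat.card W) (A : Set G)
    {δ : ℝ} (hδ0 : 0 < δ) (hδ : δ < 1 / 2)
    (hp : uniformProb (W → G) (BiInduces F U V A) < δ ^ (24 * Nat.card W ^ 2)) :
    δ ^ (24 * Nat.card W) * Fintype.card G ≤ #(almostPeriods A δ) := by
  by_contra! hlt
  set n := Nat.card W with hn
  set p := uniformProb (W → G) (BiInduces F U V A) with hpdef
  have hG : (0 : ℝ) < Fintype.card G := by exact_mod_cast Fintype.card_pos
  obtain ⟨M, hM1, hM2⟩ : ∃ M : ℕ, 100 / δ ^ 2 ≤ M ∧ (M : ℝ) ≤ 101 / δ ^ 2 := by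
    refine ⟨⌈100 / δ ^ 2⌉₊, Nat.le_ceil _, (Nat.ceil_lt_add_one (by positivity)).le.trans ?_⟩
    have : 1 ≤ 1 / δ ^ 2 := by
      rw [le_div_iff₀ (by positivity)]
      nlinarith
    calc 100 / δ ^ 2 + 1 ≤ 100 / δ ^ 2 + 1 / δ ^ 2 := by gcongr
      _ = _ := by ring
  have hM0' : (0 : ℝ) < M := lt_of_lt_of_le (by positivity) hM1
  have hM0 : 0 < M := by exact_mod_cast hM0'
  have hn0 : n ≠ 0 := hW.ne'
  -- One more than the Sauer–Shelah bound for `M * n` points. Each of the three terms of the union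
  -- bound will be at most `1 / 4`.
  set N := (3 * M) ^ n + 1 with hN
  have hMn : (1 : ℝ) ≤ (M : ℝ) ^ n := one_le_pow₀ (by exact_mod_cast hM0)
  have hNle : (N : ℝ) ≤ (4 * M) ^ n := by
    rw [hN]; push_cast
    calc (3 * (M : ℝ)) ^ n + 1 ≤ (3 * (M : ℝ)) ^ n + (M : ℝ) ^ n := by gcongr
      _ ≤ (3 * (M : ℝ) + M) ^ n := pow_add_pow_le (by positivity) (by positivity) hn0
      _ = _ := by ring
  have hNs : ((N + M * n : ℕ) : ℝ) ≤ (6 * M) ^ n := by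
    push_cast
    have h2n : (n : ℝ) ≤ 2 ^ n := by exact_mod_cast Nat.lt_two_pow_self.le
    have hMM : (M : ℝ) ≤ (M : ℝ) ^ n := le_self_pow₀ (by exact_mod_cast hM0) hn0
    calc (N : ℝ) + M * n ≤ (4 * M) ^ n + (M : ℝ) ^ n * 2 ^ n := by gcongr
      _ = (4 * M) ^ n + (2 * M : ℝ) ^ n := by rw [mul_comm (_ ^ n) (2 ^ n), ← mul_pow]
      _ ≤ (4 * (M : ℝ) + 2 * M) ^ n := pow_add_pow_le (by positivity) (by positivity) hn0
      _ = _ := by ring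
  have hpow_le : ∀ (x : ℝ) (m : ℕ), 0 ≤ x → x ≤ 1 / 4 → m ≠ 0 → x ^ m ≤ 1 / 4 := fun x m h0 h1 hm =>
    (pow_le_of_le_one h0 (by linarith) hm).trans h1
  have hδ20 : δ ^ 20 ≤ (1 / 2 : ℝ) ^ 20 := pow_le_pow_left₀ hδ0.le hδ.le 20
  have hMδ : (M : ℝ) * δ ^ 2 ≤ 101 := by
    rwa [le_div_iff₀ (by positivity)] at hM2
  have hβ : (N : ℝ) ^ 2 * ((#(almostPeriods A δ) : ℝ) / Fintype.card G) ≤ 1 / 4 := by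
    have h1 : (#(almostPeriods A δ) : ℝ) / Fintype.card G ≤ δ ^ (24 * n) := by
      rw [div_le_iff₀ hG]; exact hlt.le
    calc _ ≤ ((4 * M : ℝ) ^ n) ^ 2 * δ ^ (24 * n) := by gcongr
      -- Of the exponent `24`, four powers of `δ` cancel `M ^ 2`; the remaining twenty beat the
      -- numerical constants because `δ < 1 / 2`.
      _ = (16 * (M * δ ^ 2) ^ 2 * δ ^ 20) ^ n := by
          rw [pow_mul, ← pow_mul, mul_comm n 2, pow_mul, ← mul_pow]
          ring
      _ ≤ 1 / 4 := by
          refine hpow_le _ n (by positivity) ?_ hn0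
          calc 16 * ((M : ℝ) * δ ^ 2) ^ 2 * δ ^ 20 ≤ 16 * 101 ^ 2 * (1 / 2) ^ 20 := by gcongr
            _ ≤ 1 / 4 := by norm_num
  have hexp : (N : ℝ) ^ 2 * (1 - δ) ^ (M * n) ≤ 1 / 4 := by
    have h1 : (1 - δ) ^ (M * n) ≤ Real.exp (-(δ * M)) ^ n := by
      rw [pow_mul]
      refine pow_le_pow_left₀ (pow_nonneg (by linarith) _) ?_ n
      have : 1 - δ ≤ Real.exp (-δ) := Real.one_sub_le_exp_neg δ
      calc (1 - δ) ^ M ≤ Real.exp (-δ) ^ M := pow_le_pow_left₀ (by linarith) this M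
        _ = _ := by rw [← Real.exp_nat_mul]; congr 1; ring
    have h1δ : 0 ≤ 1 - δ := by linarith
    calc (N : ℝ) ^ 2 * (1 - δ) ^ (M * n) ≤ ((4 * M : ℝ) ^ n) ^ 2 * Real.exp (-(δ * M)) ^ n := by
          gcongr
      _ = (16 * (M : ℝ) ^ 2 * Real.exp (-(δ * M))) ^ n := by
          rw [← pow_mul, mul_comm n 2, pow_mul, ← mul_pow]
          ring
      _ ≤ 1 / 4 := hpow_le _ n (by positivity) (sq_mul_exp_neg_mul_le hδ0 hM1) hn0
  have hpat : ((N + M * n : ℕ) : ℝ) ^ n * p ≤ 1 / 4 := by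
    calc ((N + M * n : ℕ) : ℝ) ^ n * p ≤ ((6 * M : ℝ) ^ n) ^ n * δ ^ (24 * n ^ 2) := by
          have := uniformProb_nonneg (α := W → G) (BiInduces F U V A)
          gcongr
      _ = (6 * (M * δ ^ 2) * (δ ^ 2 * δ ^ 20)) ^ (n ^ 2) := by
          rw [← pow_mul, ← sq, pow_mul δ, ← mul_pow]
          ring
      _ ≤ 1 / 4 := by
          refine hpow_le _ _ (by positivity) ?_ (by positivity)
          have : δ ^ 2 ≤ 1 := pow_le_one₀ hδ0.le (by linarith)
          calc 6 * ((M : ℝ) * δ ^ 2) * (δ ^ 2 * δ ^ 20) ≤ 6 * 101 * (1 * (1 / 2) ^ 20) := by gcongr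
            _ ≤ 1 / 4 := by norm_num
  have h := le_sum_choose_of_few_patterns hF A (by linarith : δ ≤ 1) N (M * n)
    (by rw [mul_add]; linarith)
  have h' : (N : ℝ) ≤ (3 * M) ^ n := le_trans (by exact_mod_cast h) (sum_choose_le M n hM0)
  rw [hN] at h'
  push_cast at h'
  linarith

end AlmostPeriodsBound

/-! ### A large subgroup on which a set does not concentrate. -/

section Subgroup

variable {G : Type*} [AddCommGroup G] [Fintype G]

open scoped Classical in
/-- Every set `B` has a large subgroup `H` such that `B ∩ H` is not concentrated on any proper
subgroup of `H`. -/
theorem exists_addSubgroup_not_concentrated (B : Finset G) :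
    ∃ H : AddSubgroup G, #B ^ 2 ≤ Nat.card H * Fintype.card G ∧
      ∀ L < H, 2 * #{b ∈ B | b ∈ L} ^ 2 ≤ #{b ∈ B | b ∈ H} ^ 2 := by
  have : Finite (AddSubgroup G) := Finite.of_injective _ SetLike.coe_injective
  -- A maximiser of this functional works. Comparison with `⊤` bounds its size from below, using
  -- that `B ∩ H` has at most `|H|` elements. Comparison with a proper subgroup, of index at least
  -- `2`, gives the factor `2`.
  let Φ : AddSubgroup G → ℚ := fun H => (#{b ∈ B | b ∈ H} : ℚ) ^ 2 / Nat.card H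
  obtain ⟨H, hH⟩ := Finite.exists_max Φ
  have hpos : ∀ L : AddSubgroup G, (0 : ℚ) < Nat.card L := fun L => by exact_mod_cast Nat.card_pos
  refine ⟨H, ?_, fun L hL => ?_⟩
  · have h := hH ⊤
    have htop : Φ ⊤ = (#B : ℚ) ^ 2 / Fintype.card G := by
      simp [Φ]
    have hle : #{b ∈ B | b ∈ H} ≤ Nat.card H := by
      rw [Nat.card_eq_fintype_card, ← Fintype.card_coe]
      exact Fintype.card_le_of_injective (fun b => ⟨b.1, (mem_filter.1 b.2).2⟩)
        fun a b hab => Subtype.ext (congrArg (fun x : H => (x : G)) hab)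
    rw [htop] at h
    simp only [Φ] at h
    have hG : (0 : ℚ) < Fintype.card G := by exact_mod_cast Fintype.card_pos
    rw [div_le_div_iff₀ hG (hpos H)] at h
    have h' : #B ^ 2 * Nat.card H ≤ #{b ∈ B | b ∈ H} ^ 2 * Fintype.card G := by exact_mod_cast h
    have hHpos : 0 < Nat.card H := Nat.card_pos
    refine Nat.le_of_mul_le_mul_right (h'.trans ?_) hHpos
    calc #{b ∈ B | b ∈ H} ^ 2 * Fintype.card G ≤ Nat.card H ^ 2 * Fintype.card G := by gcongr
      _ = _ := by ring
  · have h := hH L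
    simp only [Φ] at h
    rw [div_le_div_iff₀ (hpos L) (hpos H)] at h
    have h' : #{b ∈ B | b ∈ L} ^ 2 * Nat.card H ≤ #{b ∈ B | b ∈ H} ^ 2 * Nat.card L := by
      exact_mod_cast h
    obtain ⟨k, hk⟩ := AddSubgroup.card_dvd_of_le hL.le
    have hLpos : 0 < Nat.card L := Nat.card_pos
    have hlt : Nat.card L < Nat.card H := by
      refine lt_of_le_of_ne (AddSubgroup.card_le_of_le hL.le) fun he => hL.ne ?_
      exact AddSubgroup.eq_of_le_of_card_ge hL.le he.ge
    have hk2 : 2 ≤ k := by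
      by_contra! hk'
      interval_cases k <;> omega
    refine Nat.le_of_mul_le_mul_right ?_ hLpos
    calc 2 * #{b ∈ B | b ∈ L} ^ 2 * Nat.card L = #{b ∈ B | b ∈ L} ^ 2 * (Nat.card L * 2) := by ring
      _ ≤ #{b ∈ B | b ∈ L} ^ 2 * (Nat.card L * k) := by gcongr
      _ = #{b ∈ B | b ∈ L} ^ 2 * Nat.card H := by rw [hk]
      _ ≤ _ := h'

end Subgroup

/-! ### Fourier analysis: from almost periods to average invariance under a subgroup. -/

section Fourier

variable {G : Type*} [AddCommGroup G] [Fintype G]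

open scoped ComplexConjugate

/-- Parseval's identity on a finite abelian group. -/
theorem sum_norm_sq_sum_mul_addChar (f : G → ℂ) :
    ∑ χ : AddChar G ℂ, ‖∑ g, f g * χ g‖ ^ 2 = Fintype.card G * ∑ g, ‖f g‖ ^ 2 := by
  classical
  have h : ((∑ χ : AddChar G ℂ, ‖∑ g, f g * χ g‖ ^ 2 : ℝ) : ℂ) =
      ((Fintype.card G * ∑ g, ‖f g‖ ^ 2 : ℝ) : ℂ) := by
    push_cast
    simp_rw [← Complex.mul_conj', map_sum, map_mul, sum_mul_sum]
    rw [sum_comm]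
    simp_rw [sum_comm (s := (univ : Finset (AddChar G ℂ)))]
    rw [mul_sum]
    refine sum_congr rfl fun g _ => ?_
    have : ∀ g', ∑ χ : AddChar G ℂ, f g * χ g * (conj (f g') * conj (χ g')) =
        if g = g' then Fintype.card G * (f g * conj (f g)) else 0 := by
      intro g'
      have h1 : ∀ χ : AddChar G ℂ, f g * χ g * (conj (f g') * conj (χ g')) =
          f g * conj (f g') * χ (g - g') := by
        intro χ
        rw [← AddChar.map_neg_eq_conj, sub_eq_add_neg, AddChar.map_add_eq_mul]
        ring
      simp_rw [h1, ← mul_sum, AddChar.sum_apply_eq_ite, sub_eq_zero]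
      by_cases hg : g = g'
      · subst hg; simp; ring
      · simp [hg]
    simp_rw [this]
    simp
  exact_mod_cast h

/-- The weights expressing `shiftDist A` as a combination of the functions `h ↦ ‖1 - χ h‖ ^ 2`. -/
theorem exists_shiftDist_eq_sum (A : Set G) : ∃ w : AddChar G ℂ → ℝ, (∀ χ, 0 ≤ w χ) ∧
    ∀ h, Fintype.card G * (shiftDist A h : ℝ) = ∑ χ, w χ * ‖1 - χ h‖ ^ 2 := by
  classical
  -- Parseval is applied to the difference of `f` and its translate, whose coefficients are those of
  -- `f` times `1 - χ (-h)`.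
  let f : G → ℂ := fun g => if g ∈ A then 1 else 0
  refine ⟨fun χ => ‖∑ g, f g * χ g‖ ^ 2, fun χ => by positivity, fun h => ?_⟩
  have hP := sum_norm_sq_sum_mul_addChar fun g => f g - f (h + g)
  have h1 : ∑ g, ‖f g - f (h + g)‖ ^ 2 = (shiftDist A h : ℝ) := by
    rw [shiftDist, card_filter]
    push_cast
    refine sum_congr rfl fun g _ => ?_
    by_cases ha : g ∈ A <;> by_cases hb : h + g ∈ A <;> simp [f, ha, hb]
  rw [← h1, ← hP]
  refine sum_congr rfl fun χ _ => ?_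
  rw [← mul_pow, ← norm_mul]
  have h2 : ∑ g, (f g - f (h + g)) * χ g = (∑ g, f g * χ g) * (1 - χ (-h)) := by
    simp_rw [sub_mul, sum_sub_distrib]
    have : ∑ g, f (h + g) * χ g = ∑ g, f g * χ (-h + g) := by
      rw [← Equiv.sum_comp (Equiv.addLeft h) (fun g => f g * χ (-h + g))]
      simp
    rw [this, mul_sub, mul_one, sum_mul]
    congr 1
    refine sum_congr rfl fun g _ => ?_
    rw [AddChar.map_add_eq_mul]
    ring
  have h3 : ‖1 - χ (-h)‖ = ‖1 - χ h‖ := by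
    rw [AddChar.map_neg_eq_conj, ← Complex.norm_conj (1 - χ h)]
    simp
  rw [h2, norm_mul, norm_mul, h3]

/-- A nontrivial `n`-th root of unity is bounded away from `1`. -/
theorem one_le_mul_norm_one_sub {ζ : ℂ} {n : ℕ} (hn : ζ ^ n = 1) (hζ : ζ ≠ 1) (hn0 : 0 < n) :
    1 ≤ n * ‖1 - ζ‖ := by
  have hnorm : ‖ζ‖ = 1 := Complex.norm_eq_one_of_pow_eq_one hn hn0.ne'
  have hsum : ∑ j ∈ range n, ζ ^ j = 0 := by
    have := mul_geom_sum ζ n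
    rw [hn, sub_self] at this
    exact (mul_eq_zero.1 this).resolve_left (sub_ne_zero.2 hζ)
  have hle : ∀ j : ℕ, ‖1 - ζ ^ j‖ ≤ j * ‖1 - ζ‖ := by
    intro j
    have h1 : 1 - ζ ^ j = (1 - ζ) * ∑ i ∈ range j, ζ ^ i := (mul_neg_geom_sum ζ j).symm
    rw [h1, norm_mul, mul_comm]
    refine mul_le_mul_of_nonneg_right ?_ (norm_nonneg _)
    refine (norm_sum_le _ _).trans ?_
    simp [hnorm]
  -- The powers of `ζ` sum to zero, and each of the `n` summands here has norm at most `n * ‖1 -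
  -- ζ‖`.
  have h2 : (n : ℂ) = ∑ j ∈ range n, (1 - ζ ^ j) := by
    rw [sum_sub_distrib, hsum]; simp
  have h3 : (n : ℝ) ≤ n * (n * ‖1 - ζ‖) := by
    calc (n : ℝ) = ‖(n : ℂ)‖ := by simp
      _ = ‖∑ j ∈ range n, (1 - ζ ^ j)‖ := by rw [← h2]
      _ ≤ ∑ j ∈ range n, ‖1 - ζ ^ j‖ := norm_sum_le _ _
      _ ≤ ∑ j ∈ range n, (n : ℝ) * ‖1 - ζ‖ := by
          refine sum_le_sum fun j hj => (hle j).trans ?_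
          have : (j : ℝ) ≤ n := by exact_mod_cast (mem_range.1 hj).le
          gcongr
      _ = _ := by simp
  have hnpos : (0 : ℝ) < n := by exact_mod_cast hn0
  nlinarith

open scoped Classical in
/-- If `B ∩ H` is not concentrated on any proper subgroup of `H`, and translating `A` by any element
of `B` changes few elements, then so does translating by the average element of `H`. -/
theorem sum_shiftDist_le {r : ℕ} (hr : AddMonoid.exponent G ≤ r) (A : Set G) {B : Finset G}
    {d : ℝ} (hB : ∀ b ∈ B, (shiftDist A b : ℝ) ≤ d) (h0 : 0 ∈ B) (H : AddSubgroup G)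
    (hH : ∀ L < H, 2 * #{b ∈ B | b ∈ L} ^ 2 ≤ #{b ∈ B | b ∈ H} ^ 2) :
    ∑ h : H, (shiftDist A h : ℝ) ≤ 16 * r ^ 2 * d * Nat.card H := by
  obtain ⟨w, hw0, hw⟩ := exists_shiftDist_eq_sum A
  obtain ⟨BH, hBH⟩ : ∃ BH : Finset G, BH = {b ∈ B | b ∈ H} := ⟨_, rfl⟩
  simp only [← hBH] at hH
  have hBHpos : (0 : ℝ) < #BH := by
    have : 0 < #BH := card_pos.2 ⟨0, by simp [hBH, h0, H.zero_mem]⟩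
    exact_mod_cast this
  have hexp : 0 < AddMonoid.exponent G := Nat.pos_of_ne_zero AddMonoid.exponent_ne_zero_of_finite
  have hr0 : 0 < r := hexp.trans_le hr
  have hG : (0 : ℝ) < Fintype.card G := by exact_mod_cast Fintype.card_pos
  -- As `shiftDist` is a nonnegative combination of the functions `‖1 - χ h‖ ^ 2`, it suffices to
  -- compare the averages over `H` and over `BH` for each character separately.
  have hterm : ∀ χ : AddChar G ℂ, (#BH : ℝ) * ∑ h : H, ‖1 - χ h‖ ^ 2 ≤
      16 * r ^ 2 * Nat.card H * ∑ b ∈ BH, ‖1 - χ b‖ ^ 2 := by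
    intro χ
    by_cases htriv : ∀ h : H, χ h = 1
    · simp only [htriv, sub_self, norm_zero]
      simp only [ne_eq, OfNat.ofNat_ne_zero, not_false_eq_true, zero_pow, sum_const_zero, mul_zero]
      positivity
    push Not at htriv
    obtain ⟨h₁, hh₁⟩ := htriv
    -- The kernel of `χ` on `H`, a proper subgroup; hence `χ` is nontrivial on a constant proportion
    -- of `BH`.
    let L : AddSubgroup G :=
      { carrier := {g | g ∈ H ∧ χ g = 1}
        add_mem' := fun {a b} ha hb => ⟨H.add_mem ha.1 hb.1, by
          rw [AddChar.map_add_eq_mul, ha.2, hb.2, one_mul]⟩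
        zero_mem' := ⟨H.zero_mem, χ.map_zero_eq_one⟩
        neg_mem' := fun {a} ha => ⟨H.neg_mem ha.1, by
          rw [AddChar.map_neg_eq_inv, ha.2, inv_one]⟩ }
    have hL : L < H := by
      refine lt_of_le_of_ne (fun g hg => hg.1) fun he => hh₁ ?_
      have : (h₁ : G) ∈ L := by rw [he]; exact h₁.2
      exact this.2
    have hcon := hH L hL
    have hfilter : ({b ∈ B | b ∈ L} : Finset G) = BH.filter fun b => χ b = 1 := by
      ext b
      simp only [hBH, mem_filter, and_assoc]
      rfl
    rw [hfilter] at hcon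
    have hsplit := card_filter_add_card_filter_not (s := BH) (fun b => χ b = 1)
    set x := #(BH.filter fun b => χ b = 1) with hx
    set y := #(BH.filter fun b => ¬ χ b = 1) with hy
    -- Otherwise `x` exceeds three quarters of `#BH`, and `2 * (3 / 4) ^ 2 > 1` contradicts
    -- non-concentration.
    have hxy : #BH ≤ 4 * y := by
      by_contra! hlt
      have h1 : 3 * #BH < 4 * x := by omega
      nlinarith
    have hlow : ((y : ℝ)) ≤ r ^ 2 * ∑ b ∈ BH, ‖1 - χ b‖ ^ 2 := by
      have h1 : ∀ b ∈ BH.filter fun b => ¬ χ b = 1, (1 : ℝ) ≤ r ^ 2 * ‖1 - χ b‖ ^ 2 := by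
        intro b hb
        have h2 : χ b ^ AddMonoid.exponent G = 1 := by
          rw [← AddChar.map_nsmul_eq_pow, AddMonoid.exponent_nsmul_eq_zero, AddChar.map_zero_eq_one]
        have h3 := one_le_mul_norm_one_sub h2 (mem_filter.1 hb).2 hexp
        have h4 : (AddMonoid.exponent G : ℝ) ≤ r := by exact_mod_cast hr
        have h5 : 1 ≤ r * ‖1 - χ b‖ := h3.trans (by gcongr)
        rw [← mul_pow]
        exact one_le_pow₀ h5
      calc (y : ℝ) = ∑ b ∈ BH.filter fun b => ¬ χ b = 1, (1 : ℝ) := by simp [y]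
        _ ≤ ∑ b ∈ BH.filter fun b => ¬ χ b = 1, (r : ℝ) ^ 2 * ‖1 - χ b‖ ^ 2 := sum_le_sum h1
        _ ≤ ∑ b ∈ BH, (r : ℝ) ^ 2 * ‖1 - χ b‖ ^ 2 :=
            sum_le_sum_of_subset_of_nonneg (filter_subset _ _) fun _ _ _ => by positivity
        _ = _ := by rw [mul_sum]
    have hup : ∑ h : H, ‖1 - χ h‖ ^ 2 ≤ 4 * Nat.card H := by
      have h1 : ∀ h : H, ‖1 - χ h‖ ^ 2 ≤ 4 := by
        intro h
        have : ‖1 - χ h‖ ≤ 2 := (norm_sub_le _ _).trans (by rw [AddChar.norm_apply]; norm_num)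
        nlinarith [norm_nonneg (1 - χ h)]
      refine (sum_le_card_nsmul _ _ _ fun h _ => h1 h).trans ?_
      rw [card_univ, Nat.card_eq_fintype_card, nsmul_eq_mul, mul_comm]
    have hxy' : (#BH : ℝ) ≤ 4 * y := by exact_mod_cast hxy
    calc (#BH : ℝ) * ∑ h : H, ‖1 - χ h‖ ^ 2
        ≤ (4 * (r ^ 2 * ∑ b ∈ BH, ‖1 - χ b‖ ^ 2)) * (4 * Nat.card H) := by
          refine mul_le_mul (hxy'.trans (by gcongr)) hup (by positivity) (by positivity)
      _ = _ := by ring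
  have hmain : (#BH : ℝ) * (Fintype.card G * ∑ h : H, (shiftDist A h : ℝ)) ≤
      16 * r ^ 2 * Nat.card H * (Fintype.card G * ∑ b ∈ BH, (shiftDist A b : ℝ)) := by
    simp_rw [mul_sum (s := univ), mul_sum (s := BH), hw]
    rw [← mul_sum, ← mul_sum, sum_comm, sum_comm (s := BH)]
    simp_rw [← mul_sum]
    rw [mul_sum, mul_sum]
    refine sum_le_sum fun χ _ => ?_
    have := mul_le_mul_of_nonneg_left (hterm χ) (hw0 χ)
    linarith
  have hsumB : ∑ b ∈ BH, (shiftDist A b : ℝ) ≤ #BH * d := by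
    rw [← nsmul_eq_mul]
    exact sum_le_card_nsmul _ _ _ fun b hb => hB b (mem_filter.1 (hBH ▸ hb)).1
  have h2 : (#BH * Fintype.card G : ℝ) * ∑ h : H, (shiftDist A h : ℝ) ≤
      (#BH * Fintype.card G : ℝ) * (16 * r ^ 2 * d * Nat.card H) := by
    calc _ = (#BH : ℝ) * (Fintype.card G * ∑ h : H, (shiftDist A h : ℝ)) := by ring
      _ ≤ _ := hmain
      _ ≤ 16 * r ^ 2 * Nat.card H * (Fintype.card G * (#BH * d)) := by gcongr
      _ = _ := by ring
  exact le_of_mul_le_mul_left h2 (by positivity)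

end Fourier

/-! ### An endomorphism of small range that is the identity modulo a subgroup. -/

section SmallRange

theorem card_sup_le {G : Type*} [AddCommGroup G] [Finite G] (H K : AddSubgroup G) :
    Nat.card ↥(H ⊔ K) ≤ Nat.card H * Nat.card K := by
  rw [← Nat.card_prod]
  refine Nat.card_le_card_of_surjective
    (fun x : H × K => (⟨x.1 + x.2, AddSubgroup.add_mem_sup x.1.2 x.2.2⟩ : ↥(H ⊔ K))) ?_
  rintro ⟨g, hg⟩
  obtain ⟨a, ha, b, hb, rfl⟩ := AddSubgroup.mem_sup.1 hg
  exact ⟨(⟨a, ha⟩, ⟨b, hb⟩), rfl⟩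

theorem card_closure_image_le {G I : Type*} [AddCommGroup G] [Finite G] {r : ℕ}
    (hr : AddMonoid.exponent G ≤ r) (g : I → G) (s : Finset I) :
    Nat.card (AddSubgroup.closure (g '' s)) ≤ r ^ #s := by
  classical
  induction s using Finset.induction_on with
  | empty => simp
  | insert a s ha ih =>
    rw [coe_insert, Set.image_insert_eq, Set.insert_eq, AddSubgroup.closure_union,
      ← AddSubgroup.zmultiples_eq_closure, card_insert_of_notMem ha, pow_succ, mul_comm]
    refine (card_sup_le _ _).trans (Nat.mul_le_mul ?_ ih)
    rw [Nat.card_zmultiples]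
    exact (Nat.le_of_dvd (Nat.pos_of_ne_zero AddMonoid.exponent_ne_zero_of_finite)
      (AddMonoid.addOrder_dvd_exponent _)).trans hr

/-- A finite abelian group generated by a family is generated by a logarithmic size subfamily. -/
theorem exists_small_generating_subset {M I : Type*} [AddCommGroup M] [Finite M] (g : I → M)
    (s : Finset I) : ∃ J ⊆ s, AddSubgroup.closure (g '' J) = AddSubgroup.closure (g '' s) ∧
      2 ^ #J ≤ Nat.card (AddSubgroup.closure (g '' s)) := by
  classical
  induction s using Finset.induction_on with
  | empty => exact ⟨∅, Subset.rfl, rfl, by simp⟩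
  | insert a s ha ih =>
    obtain ⟨J, hJs, hJ, hcard⟩ := ih
    have hins : ∀ t : Finset I, AddSubgroup.closure (g '' (insert a t : Finset I)) =
        AddSubgroup.closure {g a} ⊔ AddSubgroup.closure (g '' t) := by
      intro t
      rw [coe_insert, Set.image_insert_eq, Set.insert_eq, AddSubgroup.closure_union]
    by_cases hmem : g a ∈ AddSubgroup.closure (g '' s)
    · have h1 : AddSubgroup.closure (g '' (insert a s : Finset I)) =
          AddSubgroup.closure (g '' s) := by
        rw [hins, sup_eq_right, AddSubgroup.closure_le, Set.singleton_subset_iff]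
        exact hmem
      exact ⟨J, hJs.trans (subset_insert _ _), by rw [h1, hJ], by rw [h1]; exact hcard⟩
    -- A generator outside the current span at least doubles it, by Lagrange.
    · refine ⟨insert a J, insert_subset_insert a hJs, by rw [hins, hins, hJ], ?_⟩
      set H := AddSubgroup.closure (g '' s)
      set K := AddSubgroup.closure (g '' (insert a s : Finset I)) with hK
      have hHK : H < K := by
        rw [hK, hins]
        refine lt_of_le_of_ne le_sup_right fun he => hmem ?_
        rw [he]
        exact AddSubgroup.mem_sup_left (AddSubgroup.subset_closure rfl)
      obtain ⟨k, hk⟩ := AddSubgroup.card_dvd_of_le hHK.le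
      have hne : Nat.card H ≠ Nat.card K := fun he =>
        hHK.ne (AddSubgroup.eq_of_le_of_card_ge hHK.le he.ge)
      have hKpos : 0 < Nat.card K := Nat.card_pos
      have hk2 : 2 ≤ k := by
        by_contra! hk'
        interval_cases k <;> omega
      rw [card_insert_of_notMem (fun h => ha (hJs h)), pow_succ, hk]
      exact Nat.mul_le_mul hcard hk2

/-- In a group of bounded exponent, the identity agrees modulo a subgroup `H` with an endomorphism
whose range has size polynomial in the index of `H`. -/
theorem exists_hom_small_range {G : Type*} [AddCommGroup G] [Finite G] {r : ℕ}
    (hr : AddMonoid.exponent G ≤ r) (H : AddSubgroup G) :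
    ∃ σ : G →+ G, (∀ g, σ g - g ∈ H) ∧ Nat.card σ.range ≤ H.index ^ (r * (r + 1)) := by
  classical
  obtain ⟨ι, _, n, -, ⟨f⟩⟩ := AddCommGroup.equiv_directSum_zmod_of_finite' G
  let π := QuotientAddGroup.mk' H
  let e : ι → G := fun i => f.symm (DirectSum.of (fun i => ZMod (n i)) i 1)
  have hne : ∀ i, n i • e i = 0 := by
    intro i
    rw [← map_nsmul, ← map_nsmul]
    simp
  have hnr : ∀ i, n i ≤ r := by
    intro i
    refine le_trans (Nat.le_of_dvd (Nat.pos_of_ne_zero AddMonoid.exponent_ne_zero_of_finite) ?_) hr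
    have h : AddMonoid.exponent G • e i = 0 := AddMonoid.exponent_nsmul_eq_zero _
    rw [← map_nsmul, ← map_nsmul, EmbeddingLike.map_eq_zero_iff] at h
    have h' := DirectSum.of_injective i (h.trans (map_zero _).symm)
    rwa [nsmul_one, ZMod.natCast_eq_zero_iff] at h'
  -- Cyclic factors are grouped by order `m`, with a small subset generating each group's image in
  -- the quotient. Lifting `π (e i)` within its own group gives `x i` with `n i • x i = 0`, so that
  -- `e i ↦ x i` extends to a homomorphism.
  choose J hJs hJ hJcard using fun m : ℕ =>
    exists_small_generating_subset (fun i => π (e i)) ({i | n i = m} : Finset ι)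
  have hlift : ∀ i, ∃ x ∈ AddSubgroup.closure (e '' J (n i)), π x = π (e i) := by
    intro i
    have h1 : π (e i) ∈ AddSubgroup.closure ((fun i => π (e i)) '' J (n i)) := by
      rw [hJ]
      exact AddSubgroup.subset_closure ⟨i, by simp, rfl⟩
    have h2 : (fun i => π (e i)) '' J (n i) = π '' (e '' J (n i)) := by
      rw [Set.image_image]
    rw [h2, ← AddMonoidHom.map_closure] at h1
    exact h1
  choose x hx hπx using hlift
  have hnx : ∀ i, n i • x i = 0 := by
    intro i
    have hle : AddSubgroup.closure (e '' J (n i)) ≤ (nsmulAddMonoidHom (α := G) (n i)).ker := by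
      rw [AddSubgroup.closure_le]
      rintro _ ⟨j, hj, rfl⟩
      have : n j = n i := by simpa using hJs _ hj
      simp [AddMonoidHom.mem_ker, ← this, hne]
    simpa [AddMonoidHom.mem_ker] using hle (hx i)
  let τ : (DirectSum ι fun i => ZMod (n i)) →+ G := DirectSum.toAddMonoid fun i =>
    ZMod.lift (n i) ⟨zmultiplesHom G (x i), by simp [hnx]⟩
  have hτ : ∀ i (k : ℤ), τ (DirectSum.of (fun i => ZMod (n i)) i (k : ZMod (n i))) = k • x i := by
    intro i k
    simp only [τ, DirectSum.toAddMonoid_of, ZMod.lift_coe, zmultiplesHom_apply]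
  have hof : ∀ i (k : ℤ), f.symm (DirectSum.of (fun i => ZMod (n i)) i (k : ZMod (n i))) =
      k • e i := by
    intro i k
    rw [← map_zsmul, ← map_zsmul, zsmul_one]
  have hπτ : ∀ y, π (τ y) = π (f.symm y) := by
    intro y
    induction y using DirectSum.induction_on with
    | zero => simp
    | of i z =>
      obtain ⟨k, rfl⟩ := ZMod.intCast_surjective z
      rw [hτ, hof, map_zsmul, map_zsmul, hπx]
    | add a b ha hb => simp only [map_add, ha, hb]
  let T : Finset ι := (range (r + 1)).biUnion J
  have hrange : ∀ y, τ y ∈ AddSubgroup.closure (e '' T) := by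
    intro y
    induction y using DirectSum.induction_on with
    | zero => simp
    | of i z =>
      obtain ⟨k, rfl⟩ := ZMod.intCast_surjective z
      rw [hτ]
      refine AddSubgroup.zsmul_mem _ (AddSubgroup.closure_mono ?_ (hx i)) k
      refine Set.image_mono ?_
      exact_mod_cast subset_biUnion_of_mem J (mem_range.2 (Nat.lt_succ_of_le (hnr i)))
    | add a b ha hb =>
      rw [map_add]
      exact AddSubgroup.add_mem _ ha hb
  refine ⟨τ.comp f.toAddMonoidHom, fun g => ?_, ?_⟩
  · have h := hπτ (f g)
    rw [f.symm_apply_apply] at h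
    rw [← QuotientAddGroup.eq_zero_iff]
    change π (τ (f g) - g) = 0
    rw [map_sub, h, sub_self]
  · have hle : (τ.comp f.toAddMonoidHom).range ≤ AddSubgroup.closure (e '' T) := by
      rintro _ ⟨g, rfl⟩
      exact hrange (f g)
    have hexp : 0 < r :=
      (Nat.pos_of_ne_zero AddMonoid.exponent_ne_zero_of_finite).trans_le hr
    have hquot : ∀ m, 2 ^ #(J m) ≤ H.index := fun m =>
      (hJcard m).trans (AddSubgroup.card_le_card_addGroup _)
    calc Nat.card (τ.comp f.toAddMonoidHom).range
        ≤ Nat.card (AddSubgroup.closure (e '' T)) := AddSubgroup.card_le_of_le hle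
      _ ≤ r ^ #T := card_closure_image_le hr e T
      _ ≤ r ^ ∑ m ∈ range (r + 1), #(J m) := Nat.pow_le_pow_right hexp card_biUnion_le
      _ ≤ (2 ^ r) ^ ∑ m ∈ range (r + 1), #(J m) := Nat.pow_le_pow_left Nat.lt_two_pow_self.le _
      _ = ∏ m ∈ range (r + 1), (2 ^ #(J m)) ^ r := by
          rw [← prod_pow_eq_pow_sum]
          exact prod_congr rfl fun m _ => pow_right_comm _ _ _
      _ ≤ ∏ m ∈ range (r + 1), H.index ^ r :=
          prod_le_prod' fun m _ => Nat.pow_le_pow_left (hquot m) r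
      _ = _ := by rw [prod_const, card_range, ← pow_mul]

end SmallRange

/-! ### The removal lemma: pulling back along `σ` and perturbing one copy. -/

section Removal

variable {W : Type*} {F : SimpleGraph W} {U V : Set W} {G : Type*} [AddCommGroup G] [Fintype G]

open scoped Classical in
/-- The number of elements on which the indicator function of `A` differs from that of the preimage
of `A` under `g ↦ σ g + t`, summed over `t ∈ H`, where `σ` is the identity modulo `H`. -/
theorem sum_card_filter_hom_ne (A : Set G) (H : AddSubgroup G) [Fintype H] (σ : G →+ G)
    (hσ : ∀ g, σ g - g ∈ H) :
    ∑ t : H, #{g : G | ¬ (g ∈ A ↔ σ g + t ∈ A)} = ∑ t : H, shiftDist A t := by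
  simp only [shiftDist, card_filter]
  rw [sum_comm, sum_comm (s := (univ : Finset H))]
  refine sum_congr rfl fun g _ => ?_
  -- For fixed `g`, shifting `t` by `σ g - g ∈ H` turns a translation of `g` into one of `σ g`.
  rw [← Equiv.sum_comp (Equiv.addRight (⟨σ g - g, hσ g⟩ : H))
    (fun t : H => if ¬ (g ∈ A ↔ (t : G) + g ∈ A) then 1 else 0)]
  refine sum_congr rfl fun t _ => ?_
  have : ((t : G) + (σ g - g)) + g = σ g + t := by abel
  simp [this]

open scoped Classical in
/-- The number of triples `(q, u, v)` such that adding `b u + b v` to `q + t` changes membership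
in `A`. -/
noncomputable def perturbationCount [Fintype W] (A : Set G) (Q : AddSubgroup G) [Fintype Q]
    (t : G) (b : W → G) : ℕ :=
  #{x : Q × W × W | ¬ ((x.1 : G) + t ∈ A ↔ (b x.2.1 + b x.2.2) + (x.1 + t) ∈ A)}

/-- For a fixed triple, `t ↦ q + t` is injective, so the bad `t` number at most the shift distance
of `b u + b v`, which is subadditive. -/
theorem sum_perturbationCount_le [Fintype W] (A : Set G) (Q H : AddSubgroup G) [Fintype Q]
    [Fintype H] {δ : ℝ} {b : W → G} (hb : ∀ w, b w ∈ almostPeriods A δ) :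
    ∑ t : H, (perturbationCount A Q t b : ℝ) ≤
      Nat.card Q * Nat.card W ^ 2 * (2 * δ * Fintype.card G) := by
  classical
  have h1 : ∀ x : Q × W × W, ((∑ t : H,
      if ¬ ((x.1 : G) + t ∈ A ↔ (b x.2.1 + b x.2.2) + (x.1 + t) ∈ A) then 1 else 0 : ℕ) : ℝ) ≤
      2 * δ * Fintype.card G := by
    intro x
    rw [← card_filter]
    have h2 : #{t : H | ¬ ((x.1 : G) + t ∈ A ↔ (b x.2.1 + b x.2.2) + (x.1 + t) ∈ A)} ≤
        shiftDist A (b x.2.1 + b x.2.2) := by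
      refine card_le_card_of_injOn (fun t : H => (x.1 : G) + t) ?_ ?_
      · intro t ht
        simpa using ht
      · intro t _ t' _ h
        exact Subtype.ext (add_left_cancel h)
    have h3 := h2.trans (shiftDist_add_le A _ _)
    have h4 := mem_almostPeriods.1 (hb x.2.1)
    have h5 := mem_almostPeriods.1 (hb x.2.2)
    have h6 : ((#{t : H | ¬ ((x.1 : G) + t ∈ A ↔ (b x.2.1 + b x.2.2) + (x.1 + t) ∈ A)} : ℕ) : ℝ) ≤
        shiftDist A (b x.2.1) + shiftDist A (b x.2.2) := by exact_mod_cast h3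
    linarith
  have h2 : (∑ t : H, (perturbationCount A Q t b : ℝ)) = ∑ x : Q × W × W, ((∑ t : H,
      if ¬ ((x.1 : G) + t ∈ A ↔ (b x.2.1 + b x.2.2) + (x.1 + t) ∈ A) then 1 else 0 : ℕ) : ℝ) := by
    simp only [perturbationCount, card_filter]
    push_cast
    rw [sum_comm]
  rw [h2]
  refine (sum_le_card_nsmul _ _ _ fun x _ => h1 x).trans (le_of_eq ?_)
  simp only [card_univ, Fintype.card_prod, nsmul_eq_mul, Nat.card_eq_fintype_card]
  push_cast
  ring

open scoped Classical in
/-- If `A` is far from bi-induced-`F`-free, then perturbing one copy of `F` by almost periods of `A`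
gives many maps that bi-induce `F` in `A`. -/
theorem card_almostPeriods_pow_le [Fintype W] (hF : HasBipartition F U V) {ε δ : ℝ} (hε : 0 < ε)
    (hδ : 0 ≤ δ) (A : Set G) (hA : IsFarFromFree F U V ε A) (H : AddSubgroup G) (σ : G →+ G)
    (hσ : ∀ g, σ g - g ∈ H)
    (hH : ∑ t : H, (shiftDist A t : ℝ) ≤ ε / 4 * Fintype.card G * Nat.card H)
    (hQ : Nat.card σ.range * (Nat.card W : ℝ) ^ 2 * (2 * δ * Fintype.card G) ≤ Nat.card H / 4) :
    (#(almostPeriods A δ) : ℝ) ^ Nat.card W ≤ 2 * #{φ : W → G | BiInduces F U V A φ} := by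
  obtain ⟨B, hB⟩ : ∃ B, B = almostPeriods A δ := ⟨_, rfl⟩
  have hB0 : (0 : ℝ) < #B := by
    have : 0 < #B := card_pos.2 ⟨0, hB ▸ zero_mem_almostPeriods A hδ⟩
    exact_mod_cast this
  have hG : (0 : ℝ) < Fintype.card G := by exact_mod_cast Fintype.card_pos
  have hHpos : (0 : ℝ) < Nat.card H := by exact_mod_cast Nat.card_pos
  rw [← hB]
  set P : Finset (W → G) := Fintype.piFinset fun _ => B with hP
  set K : ℝ := (#B : ℝ) ^ Nat.card W with hK
  have hPcard : (#P : ℝ) = K := by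
    rw [hP, Fintype.card_piFinset, prod_const, card_univ, hK, Nat.card_eq_fintype_card]
    push_cast
    rfl
  have hKpos : 0 < K := by positivity
  let S₁ : H → ℝ := fun t => (#{g : G | ¬ (g ∈ A ↔ σ g + t ∈ A)} : ℝ)
  let S₂ : H → ℝ := fun t => ∑ b ∈ P, (perturbationCount A σ.range t b : ℝ)
  have hS₁ : ∑ t, S₁ t ≤ ε / 4 * Fintype.card G * Nat.card H := by
    refine le_trans (le_of_eq ?_) hH
    simp only [S₁]
    exact_mod_cast sum_card_filter_hom_ne A H σ hσ
  have hS₂ : ∑ t, S₂ t ≤ K * (Nat.card H / 4) := by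
    simp only [S₂]
    rw [sum_comm, ← hPcard, ← nsmul_eq_mul]
    refine sum_le_card_nsmul _ _ _ fun b hb => le_trans ?_ hQ
    refine sum_perturbationCount_le A σ.range H fun w => ?_
    rw [← hB]
    exact Fintype.mem_piFinset.1 hb w
  -- One averaging controls both quantities: the means contribute `1 / 4` and `1 / 2` of `ε * |G| *
  -- K`. The resulting `t` has a pullback within `ε * |G|` of `A` and spoils at most half of the
  -- perturbations.
  obtain ⟨t, -, ht⟩ : ∃ t ∈ (univ : Finset H), S₁ t * K + 2 * S₂ t * (ε * Fintype.card G) ≤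
      3 / 4 * (ε * Fintype.card G * K) := by
    refine exists_le_of_sum_le univ_nonempty ?_
    rw [sum_add_distrib, ← sum_mul, ← sum_mul, ← mul_sum, sum_const, card_univ, nsmul_eq_mul,
      ← Nat.card_eq_fintype_card (α := H)]
    calc (∑ t, S₁ t) * K + 2 * (∑ t, S₂ t) * (ε * Fintype.card G)
        ≤ (ε / 4 * Fintype.card G * Nat.card H) * K +
          2 * (K * (Nat.card H / 4)) * (ε * Fintype.card G) := by gcongr
      _ = _ := by ring
  have hS₁0 : 0 ≤ S₁ t := Nat.cast_nonneg _
  have hS₂0 : 0 ≤ S₂ t := sum_nonneg fun _ _ => Nat.cast_nonneg _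
  have hεG : 0 < ε * Fintype.card G := by positivity
  have h₁ : S₁ t ≤ ε * Fintype.card G := by
    have : S₁ t * K ≤ ε * Fintype.card G * K := by
      have := mul_nonneg hS₂0 hεG.le
      have := mul_pos hεG hKpos
      linarith
    exact le_of_mul_le_mul_right this hKpos
  have h₂ : 2 * S₂ t ≤ K := by
    have : 2 * S₂ t * (ε * Fintype.card G) ≤ K * (ε * Fintype.card G) := by
      have := mul_nonneg hS₁0 hKpos.le
      have := mul_pos hεG hKpos
      linarith
    exact le_of_mul_le_mul_right this hεG
  obtain ⟨φ₀, hφ₀, -, -⟩ := hA {g | σ g + t ∈ A} (by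
    refine le_trans (le_of_eq ?_) (h₁.trans (le_of_eq (by rw [Nat.card_eq_fintype_card])))
    simp only [S₁]
    rw [← Set.ncard_coe_finset]
    congr 2
    ext g
    simp only [Set.mem_symmDiff, Set.mem_ofPred_eq, coe_filter, mem_univ, true_and]
    tauto)
  -- The shift `t` is added on `U` only, so that it occurs exactly once in each sum over a pair in
  -- `U × V`.
  let Φ : (W → G) → W → G := fun b w => σ (φ₀ w) + b w + if w ∈ U then (t : G) else 0
  have hΦinj : Function.Injective Φ := by
    intro b b' h
    funext w
    have := congrFun h w
    simpa [Φ] using this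
  have hUV : ∀ w, w ∈ V → w ∉ U := fun w hv hu => Set.disjoint_left.1 hF.1.disjoint hu hv
  have hgood : ∀ b, perturbationCount A σ.range t b = 0 → BiInduces F U V A (Φ b) := by
    intro b hb u hu v hv
    rw [hφ₀ u hu v hv]
    rw [perturbationCount, card_eq_zero, filter_eq_empty_iff] at hb
    have h := hb (mem_univ (⟨σ (φ₀ u + φ₀ v), ⟨_, rfl⟩⟩, u, v))
    rw [not_not] at h
    refine Iff.trans (Iff.trans (by rfl) h) ?_
    have : (b u + b v) + (σ (φ₀ u + φ₀ v) + t) = Φ b u + Φ b v := by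
      simp only [Φ, hu, hUV v hv, if_true, if_false, map_add]
      abel
    simp only [this]
  have hsplit := card_filter_add_card_filter_not (s := P)
    (fun b => perturbationCount A σ.range t b = 0)
  have hbad : ((#{b ∈ P | ¬ perturbationCount A σ.range t b = 0} : ℕ) : ℝ) ≤ S₂ t := by
    rw [card_filter]
    push_cast
    refine sum_le_sum fun b _ => ?_
    split_ifs with h
    · exact Nat.cast_nonneg _
    · exact_mod_cast Nat.one_le_iff_ne_zero.2 h
  have hgoodcard : #{b ∈ P | perturbationCount A σ.range t b = 0} ≤
      #{φ : W → G | BiInduces F U V A φ} := by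
    refine card_le_card_of_injOn Φ ?_ hΦinj.injOn
    intro b hb
    have := hgood b (mem_filter.1 hb).2
    simpa using this
  have hgc : ((#{b ∈ P | perturbationCount A σ.range t b = 0} : ℕ) : ℝ) ≤
      #{φ : W → G | BiInduces F U V A φ} := by exact_mod_cast hgoodcard
  have hsplit' : ((#{b ∈ P | perturbationCount A σ.range t b = 0} : ℕ) : ℝ) +
      ((#{b ∈ P | ¬ perturbationCount A σ.range t b = 0} : ℕ) : ℝ) = K := by
    rw [← hPcard]
    exact_mod_cast hsplit
  linarith

/-- The bi-induced removal lemma, with an explicit exponent. -/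
theorem removal_lemma [Finite W] {r : ℕ} (hr : AddMonoid.exponent G ≤ r)
    (hF : HasBipartition F U V) (hW : 0 < Nat.card W) {ε : ℝ} (hε : 0 < ε) (hε2 : ε < 1 / 2)
    (A : Set G) (hA : IsFarFromFree F U V ε A) {a m : ℕ} (ha : a = 2 * r + 7)
    (hm : m = 48 * a * (r * (r + 1) + 1) + 5) :
    ε ^ ((24 * m + 1) * Nat.card W ^ 3) ≤ uniformProb (W → G) (BiInduces F U V A) := by
  classical
  have := Fintype.ofFinite W
  by_contra! hlt
  set n := Nat.card W with hn
  have hε1 : ε ≤ 1 := by linarith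
  have hmono : ∀ {i j : ℕ}, i ≤ j → ε ^ j ≤ ε ^ i := fun h => pow_le_pow_of_le_one hε.le hε1 h
  have hhalf : ∀ k : ℕ, (2 : ℝ) ^ k * ε ^ k ≤ 1 := by
    intro k
    rw [← mul_pow]
    exact pow_le_one₀ (by positivity) (by linarith)
  have hG : (0 : ℝ) < Fintype.card G := by exact_mod_cast Fintype.card_pos
  have hn1 : 1 ≤ n := hW
  have hn23 : n ^ 2 ≤ n ^ 3 := Nat.pow_le_pow_right hn1 (by norm_num)
  have hlt_half : ∀ k : ℕ, k ≠ 0 → ε ^ k < 1 / 2 := fun k hk =>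
    (pow_le_of_le_one hε.le hε1 hk).trans_lt hε2
  have ham : a ≤ m := by
    rw [hm]; nlinarith [Nat.zero_le (a * (r * (r + 1)))]
  -- Almost periods are used at two scales: the coarse `ε ^ a` yields `H`, and the fine `ε ^ (m *
  -- n)` supplies the perturbations.
  have hp₁ : uniformProb (W → G) (BiInduces F U V A) < (ε ^ a) ^ (24 * n ^ 2) := by
    refine hlt.trans_le ?_
    rw [← pow_mul]
    refine hmono ?_
    calc a * (24 * n ^ 2) ≤ m * (24 * n ^ 3) := by gcongr
      _ ≤ _ := by nlinarith [Nat.zero_le (n ^ 3)]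
  have hp₂ : uniformProb (W → G) (BiInduces F U V A) < (ε ^ (m * n)) ^ (24 * n ^ 2) := by
    refine hlt.trans_le ?_
    rw [← pow_mul]
    refine hmono ?_
    calc m * n * (24 * n ^ 2) = 24 * m * n ^ 3 := by ring
      _ ≤ _ := by gcongr; omega
  have ha0 : a ≠ 0 := by omega
  have hm0 : m * n ≠ 0 := Nat.mul_ne_zero (by omega) (by omega)
  have hB₁ := card_almostPeriods_ge hF hW A (pow_pos hε a) (hlt_half a ha0) hp₁
  have hB₂ := card_almostPeriods_ge hF hW A (pow_pos hε (m * n)) (hlt_half _ hm0) hp₂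
  obtain ⟨H, hHcard, hHconc⟩ := exists_addSubgroup_not_concentrated (almostPeriods A (ε ^ a))
  have hHsum := sum_shiftDist_le hr A (fun b hb => mem_almostPeriods.1 hb)
    (zero_mem_almostPeriods A (pow_nonneg hε.le a)) H (fun L hL => by
      convert hHconc L hL)
  obtain ⟨σ, hσ, hσr⟩ := exists_hom_small_range hr H
  -- With `r ≤ 2 ^ r`, the loss `64 * r ^ 2` is at most `2 ^ (2 * r + 6)`; this and one spare `ε`
  -- account for `a = 2 * r + 7`.
  have hr2 : 16 * (r : ℝ) ^ 2 * ε ^ a ≤ ε / 4 := by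
    have h1 : (r : ℝ) ≤ 2 ^ r := by exact_mod_cast Nat.lt_two_pow_self.le
    calc 16 * (r : ℝ) ^ 2 * ε ^ a ≤ 16 * ((2 : ℝ) ^ r) ^ 2 * ε ^ a := by gcongr
      _ = (2 ^ (2 * r + 6) * ε ^ (2 * r + 6)) * (ε / 4) := by
          rw [ha]; ring
      _ ≤ 1 * (ε / 4) := by gcongr; exact hhalf _
      _ = _ := one_mul _
  have hHpos : (0 : ℝ) < Nat.card H := by exact_mod_cast Nat.card_pos
  have hH1 : ∑ t : H, (shiftDist A t : ℝ) ≤ ε / 4 * Fintype.card G * Nat.card H := by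
    refine hHsum.trans ?_
    rw [← mul_assoc]
    gcongr
  have hindex : ε ^ (48 * a * n) * (H.index : ℝ) ≤ 1 := by
    have h1 : ((Nat.card H : ℝ)) * H.index = Fintype.card G := by
      rw [← Nat.card_eq_fintype_card]
      exact_mod_cast H.card_mul_index
    have h2 : ((ε ^ a) ^ (24 * n) * Fintype.card G) ^ 2 ≤ Nat.card H * Fintype.card G := by
      refine (pow_le_pow_left₀ (by positivity) hB₁ 2).trans ?_
      exact_mod_cast hHcard
    have h3 : ε ^ (48 * a * n) * Fintype.card G ≤ Nat.card H := by
      refine le_of_mul_le_mul_right ?_ hG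
      refine le_trans (le_of_eq ?_) h2
      rw [mul_pow, ← pow_mul, ← pow_mul]
      ring
    rw [← h1] at h3
    refine le_of_mul_le_mul_right ?_ hHpos
    linarith
  have hQ : Nat.card σ.range * (n : ℝ) ^ 2 * (2 * ε ^ (m * n) * Fintype.card G) ≤
      Nat.card H / 4 := by
    set k := r * (r + 1) with hk
    have h1 : ((Nat.card H : ℝ)) * H.index = Fintype.card G := by
      rw [← Nat.card_eq_fintype_card]
      exact_mod_cast H.card_mul_index
    have h2 : (Nat.card σ.range : ℝ) ≤ (H.index : ℝ) ^ k := by exact_mod_cast hσr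
    have h3 : (n : ℝ) ≤ 2 ^ n := by exact_mod_cast Nat.lt_two_pow_self.le
    have h4 : (8 : ℝ) ≤ 8 ^ n := le_self_pow₀ (by norm_num) (by omega)
    -- This explains `m`: `k` factors pay for the range of `σ`, one for the density of `H`, and `ε ^
    -- (5 * n)` absorbs `8 * n ^ 2`.
    have h5 : ε ^ (m * n) = (ε ^ (48 * a * n)) ^ (k + 1) * ε ^ (5 * n) := by
      rw [← pow_mul, ← pow_add, hm]
      congr 1
      ring
    have h6 : (8 : ℝ) * (n : ℝ) ^ 2 * ε ^ (5 * n) ≤ 1 := by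
      calc (8 : ℝ) * (n : ℝ) ^ 2 * ε ^ (5 * n) ≤ 8 ^ n * ((2 : ℝ) ^ n) ^ 2 * ε ^ (5 * n) := by
            gcongr
        _ = 2 ^ (5 * n) * ε ^ (5 * n) := by
            rw [pow_mul 2 5 n, ← pow_mul, mul_comm n 2, pow_mul, ← mul_pow]
            norm_num
        _ ≤ 1 := hhalf _
    have h7 : (ε ^ (48 * a * n) * (H.index : ℝ)) ^ (k + 1) ≤ 1 :=
      pow_le_one₀ (by positivity) hindex
    calc Nat.card σ.range * (n : ℝ) ^ 2 * (2 * ε ^ (m * n) * Fintype.card G)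
        ≤ (H.index : ℝ) ^ k * (n : ℝ) ^ 2 *
          (2 * ((ε ^ (48 * a * n)) ^ (k + 1) * ε ^ (5 * n)) * (Nat.card H * H.index)) := by
          rw [h5, h1]
          gcongr
      _ = (ε ^ (48 * a * n) * (H.index : ℝ)) ^ (k + 1) * (8 * (n : ℝ) ^ 2 * ε ^ (5 * n)) *
          (Nat.card H / 4) := by
          rw [mul_pow (ε ^ (48 * a * n))]
          ring
      _ ≤ 1 * 1 * (Nat.card H / 4) := by gcongr
      _ = _ := by ring
  have hmain := card_almostPeriods_pow_le hF hε (pow_nonneg hε.le (m * n)) A hA H σ hσ hH1 hQ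
  rw [← hn] at hmain
  have hfin : (ε ^ (m * n)) ^ (24 * n ^ 2) ≤
      2 * uniformProb (W → G) (BiInduces F U V A) := by
    rw [uniformProb_eq_card_filter, ← mul_div_assoc, le_div_iff₀ (by positivity)]
    refine le_trans ?_ hmain
    refine le_trans (le_of_eq ?_) (pow_le_pow_left₀ (by positivity) hB₂ n)
    rw [mul_pow, Fintype.card_fun, ← Nat.card_eq_fintype_card (α := W), ← hn]
    push_cast
    ring
  have hlast : ε ^ ((24 * m + 1) * n ^ 3) ≤ (ε ^ (m * n)) ^ (24 * n ^ 2) / 2 := by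
    rw [← pow_mul]
    have h1 : ε ^ (n ^ 3) ≤ 1 / 2 := (hlt_half _ (by positivity)).le
    calc ε ^ ((24 * m + 1) * n ^ 3) = ε ^ (m * n * (24 * n ^ 2)) * ε ^ (n ^ 3) := by
          rw [← pow_add]; congr 1; ring
      _ ≤ ε ^ (m * n * (24 * n ^ 2)) * (1 / 2) := by gcongr
      _ = _ := by ring
  linarith

theorem uniformProb_eq_one_of_forall {α : Type*} [Finite α] [Nonempty α] {p : α → Prop}
    (h : ∀ x, p x) : uniformProb α p = 1 := by
  have hc : Nat.card {x // p x} = Nat.card α := Nat.card_congr (Equiv.subtypeUnivEquiv h)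
  rw [uniformProb, hc, div_self (by exact_mod_cast Nat.card_pos.ne')]

end Removal

/-! ### From bi-inducing maps to injective copies, and the tester. -/

section Testing

theorem uniformProb_forall_fin {α : Type*} [Finite α] (q : α → Prop) (t : ℕ) :
    uniformProb (Fin t → α) (fun Φ => ∀ i, q (Φ i)) = uniformProb α q ^ t := by
  classical
  have := Fintype.ofFinite α
  rw [uniformProb_eq_card_filter, uniformProb_eq_card_filter, div_pow]
  have h : ({Φ : Fin t → α | ∀ i, q (Φ i)} : Finset _) =
      Fintype.piFinset fun _ : Fin t => ({x | q x} : Finset α) := by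
    ext; simp [Fintype.mem_piFinset]
  rw [h, Fintype.card_piFinset]
  simp

theorem inv_card_le_uniformProb {α : Type*} [Finite α] {p : α → Prop} (h : ∃ x, p x) :
    1 / (Nat.card α : ℝ) ≤ uniformProb α p := by
  obtain ⟨x, hx⟩ := h
  have : Nonempty {x // p x} := ⟨x, hx⟩
  unfold uniformProb
  gcongr
  exact_mod_cast Nat.card_pos (α := {x // p x})

theorem uniformProb_apply_eq_apply {W G : Type*} [Finite W] [Finite G] [Nonempty G] {x y : W}
    (hxy : x ≠ y) : uniformProb (W → G) (fun φ => φ x = φ y) = 1 / Nat.card G := by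
  have hκ : Function.Injective ![x, y] := by
    intro a b hab
    fin_cases a <;> fin_cases b <;> simp_all
  have h1 := uniformProb_comp_injective (G := G) hκ (fun w => w 0 = w 1)
  have h2 := uniformProb_congr_equiv (finTwoArrowEquiv G) (fun w => w.1 = w.2)
  refine h1.trans (h2.trans ?_)
  let e : {w : G × G // w.1 = w.2} ≃ G :=
    { toFun := fun w => w.1.1
      invFun := fun g => ⟨(g, g), rfl⟩
      left_inv := fun w => Subtype.ext (Prod.ext rfl w.2)
      right_inv := fun _ => rfl }
  have hG : (Nat.card G : ℝ) ≠ 0 := by exact_mod_cast Nat.card_pos.ne'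
  rw [uniformProb, Nat.card_congr e, Nat.card_prod]
  push_cast
  field_simp

theorem uniformProb_not_injective_le {W G : Type*} [Finite W] [Finite G] [Nonempty G] :
    uniformProb (W → G) (fun φ => ¬ Function.Injective φ) ≤
      (Nat.card W : ℝ) ^ 2 / Nat.card G := by
  classical
  have := Fintype.ofFinite W
  let p : {x : W × W // x.1 ≠ x.2} → (W → G) → Prop := fun x φ => φ x.1.1 = φ x.1.2
  have h1 : uniformProb (W → G) (fun φ => ¬ Function.Injective φ) ≤
      uniformProb (W → G) (fun φ => ∃ x, p x φ) := by
    refine uniformProb_mono fun φ hφ => ?_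
    rw [Function.not_injective_iff] at hφ
    obtain ⟨x, y, h, hne⟩ := hφ
    exact ⟨⟨(x, y), hne⟩, h⟩
  refine h1.trans ((uniformProb_exists_le p).trans ?_)
  have h2 : ∀ x, uniformProb (W → G) (p x) = 1 / Nat.card G := fun x =>
    uniformProb_apply_eq_apply x.2
  simp_rw [h2]
  rw [sum_const, card_univ, nsmul_eq_mul, ← mul_div_assoc, mul_one]
  gcongr
  have : Fintype.card {x : W × W // x.1 ≠ x.2} ≤ Nat.card W ^ 2 :=
    (Fintype.card_subtype_le _).trans (by simp [sq, Nat.card_eq_fintype_card])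
  exact_mod_cast this

variable {W : Type*} [Finite W] {F : SimpleGraph W} {U V : Set W} {G : Type*} [AddCommGroup G]
  [Finite G]

/-- Passing from bi-inducing maps to bi-induced copies costs a bounded power of `ε`. -/
theorem uniformProb_isBiInducedCopy_ge {ε : ℝ} (hε : 0 < ε) (hε2 : ε < 1 / 2) {A : Set G}
    (hA : IsFarFromFree F U V ε A) {E : ℕ}
    (hE : ε ^ E ≤ uniformProb (W → G) (BiInduces F U V A)) :
    ε ^ ((E + 2 * Nat.card W + 1) * (Nat.card W + 1)) ≤
      uniformProb (W → G) (IsBiInducedCopy F U V A) := by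
  set n := Nat.card W with hn
  have hG : (0 : ℝ) < Nat.card G := by exact_mod_cast Nat.card_pos
  have hε1 : ε ≤ 1 := by linarith
  have hmono : ∀ {i j : ℕ}, i ≤ j → ε ^ j ≤ ε ^ i := fun h => pow_le_pow_of_le_one hε.le hε1 h
  -- In a large group, non-injective maps have probability at most `ε ^ (E + 1)`, at most half of
  -- the given bound. In a small group, farness with `A' = A` gives one copy, of probability at
  -- least `|G| ^ (-n)`.
  by_cases hcase : 1 ≤ Nat.card G * ε ^ (E + 2 * n + 1)
  · have h1 : uniformProb (W → G) (BiInduces F U V A) ≤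
        uniformProb (W → G) (IsBiInducedCopy F U V A) +
          uniformProb (W → G) (fun φ => ¬ Function.Injective φ) := by
      refine le_trans (uniformProb_mono fun φ hφ => ?_) (uniformProb_or_le _ _)
      by_cases hinj : Function.Injective φ
      · exact Or.inl ⟨hφ, hinj.injOn, hinj.injOn⟩
      · exact Or.inr hinj
    have h2 := uniformProb_not_injective_le (W := W) (G := G)
    have h3 : (n : ℝ) ^ 2 / Nat.card G ≤ ε ^ (E + 1) := by
      rw [div_le_iff₀ hG]
      have h4 : (n : ℝ) ≤ 2 ^ n := by exact_mod_cast Nat.lt_two_pow_self.le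
      have h5 : (n : ℝ) ^ 2 * ε ^ (2 * n) ≤ 1 := by
        calc (n : ℝ) ^ 2 * ε ^ (2 * n) ≤ ((2 : ℝ) ^ n) ^ 2 * ε ^ (2 * n) := by gcongr
          _ = (2 * ε) ^ (2 * n) := by rw [← pow_mul, mul_comm n 2, ← mul_pow]
          _ ≤ 1 := pow_le_one₀ (by positivity) (by linarith)
      calc (n : ℝ) ^ 2 ≤ (n : ℝ) ^ 2 * (Nat.card G * ε ^ (E + 2 * n + 1)) :=
            le_mul_of_one_le_right (by positivity) hcase
        _ = ((n : ℝ) ^ 2 * ε ^ (2 * n)) * (ε ^ (E + 1) * Nat.card G) := by ring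
        _ ≤ 1 * (ε ^ (E + 1) * Nat.card G) := by gcongr
        _ = _ := one_mul _
    have h6 : ε ^ (E + 1) ≤ ε ^ E / 2 := by
      rw [pow_succ]
      have := pow_pos hε E
      nlinarith
    have h7 : ε ^ ((E + 2 * n + 1) * (n + 1)) ≤ ε ^ (E + 1) := hmono (by nlinarith)
    linarith
  · push Not at hcase
    have hcopy : HasBiInducedCopy F U V A := hA A (by
      rw [symmDiff_self]
      simp only [Set.bot_eq_empty, Set.ncard_empty, Nat.cast_zero]
      positivity)
    refine le_trans ?_ (inv_card_le_uniformProb hcopy)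
    rw [Nat.card_fun, ← hn]
    push_cast
    rw [le_div_iff₀ (by positivity)]
    calc ε ^ ((E + 2 * n + 1) * (n + 1)) * (Nat.card G : ℝ) ^ n
        = ε ^ (E + 2 * n + 1) * (Nat.card G * ε ^ (E + 2 * n + 1)) ^ n := by
          rw [mul_add_one, pow_add, pow_mul, mul_pow]
          ring
      _ ≤ 1 * 1 := by
          gcongr
          · exact pow_le_one₀ hε.le hε1
          · exact pow_le_one₀ (by positivity) hcase.le
      _ = 1 := one_mul 1

theorem two_thirds_le_uniformProb_testerSaysYes {A : Set G} {p₀ : ℝ}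
    (hp : p₀ ≤ uniformProb (W → G) (IsBiInducedCopy F U V A)) {t : ℕ} (ht : 2 ≤ p₀ * t) :
    2 / 3 ≤ uniformProb (Fin t → W → G) (TesterSaysYes F U V A) := by
  set p := uniformProb (W → G) (IsBiInducedCopy F U V A) with hpdef
  have h1 : uniformProb (Fin t → W → G) (fun Φ => ¬ TesterSaysYes F U V A Φ) = (1 - p) ^ t := by
    rw [← uniformProb_not, ← uniformProb_forall_fin]
    congr 1
    funext Φ
    simp [TesterSaysYes]
  have h2 : 0 ≤ 1 - p := by
    rw [← uniformProb_not]
    exact uniformProb_nonneg _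
  have h3 : (1 - p) ^ t ≤ 1 / 3 := by
    calc (1 - p) ^ t ≤ Real.exp (-p) ^ t := pow_le_pow_left₀ h2 (Real.one_sub_le_exp_neg p) t
      _ = Real.exp (-(p * t)) := by
          rw [← Real.exp_nat_mul]; congr 1; ring
      _ ≤ Real.exp (-2) := by
          refine Real.exp_le_exp.2 (neg_le_neg (ht.trans ?_))
          gcongr
      _ ≤ 1 / 3 := by
          rw [Real.exp_neg, one_div]
          refine inv_anti₀ (by norm_num) ?_
          have := Real.add_one_le_exp (2 : ℝ)
          linarith
  rw [uniformProb_not] at h1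
  linarith

theorem exists_removal_exponent (r : ℕ) : ∃ C : ℕ, ∀ (W : Type u) [Finite W] (F : SimpleGraph W)
    (U V : Set W), HasBipartition F U V →
    ∀ (G : Type v) [AddCommGroup G] [Finite G], AddMonoid.exponent G ≤ r →
    ∀ ε : ℝ, 0 < ε → ε < 1 / 2 → ∀ A : Set G, IsFarFromFree F U V ε A →
      ε ^ (C * Nat.card W ^ 3) ≤ uniformProb (W → G) (BiInduces F U V A) := by
  refine ⟨24 * (48 * (2 * r + 7) * (r * (r + 1) + 1) + 5) + 1,
    fun W _ F U V hF G _ _ hr ε hε hε2 A hA => ?_⟩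
  have := Fintype.ofFinite G
  -- Without vertices the exponent is `0` and every map bi-induces `F`.
  rcases Nat.eq_zero_or_pos (Nat.card W) with h0 | hW
  · have : IsEmpty W := Finite.card_eq_zero_iff.1 h0
    have hall : ∀ φ : W → G, BiInduces F U V A φ := fun φ u => isEmptyElim u
    rw [h0, uniformProb_eq_one_of_forall hall]
    simp
  · exact removal_lemma hr hF hW hε hε2 A hA rfl rfl

end Testing

end BiInduced


theorem theorem2 (r : ℕ) (hr : 0 < r) :
    -- removal lemma; the constant in the exponent depends on `r` only
    (∃ C : ℕ, ∀ (W : Type u) [Finite W] (F : SimpleGraph W) (U V : Set W),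
      BiInduced.HasBipartition F U V →
      ∀ (G : Type v) [AddCommGroup G] [Finite G], AddMonoid.exponent G ≤ r →
      ∀ ε : ℝ, 0 < ε → ε < 1 / 2 →
      ∀ A : Set G, BiInduced.IsFarFromFree F U V ε A →
        ε ^ (C * Nat.card W ^ 3) ≤
          BiInduced.uniformProb (W → G) (BiInduced.BiInduces F U V A)) ∧
    -- property testing with polynomially many samples
    (∀ (W : Type u) [Finite W] (F : SimpleGraph W) (U V : Set W),
      BiInduced.HasBipartition F U V →
      ∃ D : ℕ, ∀ ε : ℝ, 0 < ε → ε < 1 / 2 →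
      ∃ t : ℕ, (t : ℝ) ≤ (1 / ε) ^ D ∧
      ∀ (G : Type v) [AddCommGroup G] [Finite G], AddMonoid.exponent G ≤ r →
      ∀ A : Set G,
        (¬ BiInduced.HasBiInducedCopy F U V A →
          ∀ Φ : Fin t → W → G, ¬ BiInduced.TesterSaysYes F U V A Φ) ∧
        (BiInduced.IsFarFromFree F U V ε A →
          2 / 3 ≤ BiInduced.uniformProb (Fin t → W → G)
            (BiInduced.TesterSaysYes F U V A))) := by

  obtain ⟨C, hC⟩ := BiInduced.exists_removal_exponent.{u, v} r
  refine ⟨⟨C, hC⟩, fun W _ F U V hF => ?_⟩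
  set E := (C * Nat.card W ^ 3 + 2 * Nat.card W + 1) * (Nat.card W + 1) with hE
  -- With success probability at least `ε ^ E` per round, this many rounds give at least two
  -- expected successes, so failure has probability at most `exp (-2) ≤ 1 / 3`. The extra `2` in the
  -- exponent absorbs the constant and the rounding, as `1 / ε ≥ 2`.
  refine ⟨E + 2, fun ε hε hε2 => ⟨⌈2 / ε ^ E⌉₊, ?_, fun G _ _ hG A => ⟨?_, fun hA => ?_⟩⟩⟩
  · have hinv : 2 ≤ 1 / ε := by
      rw [le_div_iff₀ hε]; linarith
    have h1 : 1 ≤ (1 / ε) ^ E := one_le_pow₀ (by linarith)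
    calc (⌈2 / ε ^ E⌉₊ : ℝ) ≤ 2 / ε ^ E + 1 := (Nat.ceil_lt_add_one (by positivity)).le
      _ = 2 * (1 / ε) ^ E + 1 := by rw [one_div_pow]; ring
      _ ≤ (1 / ε) ^ E * 2 ^ 2 := by linarith
      _ ≤ (1 / ε) ^ E * (1 / ε) ^ 2 := by gcongr
      _ = (1 / ε) ^ (E + 2) := (pow_add _ _ _).symm
  · rintro hfree Φ ⟨i, hi⟩
    exact hfree ⟨Φ i, hi⟩
  · refine BiInduced.two_thirds_le_uniformProb_testerSaysYes
      (BiInduced.uniformProb_isBiInducedCopy_ge hε hε2 hA (hC W F U V hF G hG ε hε hε2 A hA)) ?_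
    rw [← div_le_iff₀' (by positivity)]
    exact Nat.le_ceil _
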